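/- Let $h_1,h_2,\dots$ be IID real random variables on a probability space $(\Omega,\mathcal F,\mathbb P)$ with $\mathbb E[e^{th_1}]<\infty$ for all $t\in\mathbb R$, and write $\vec h=(h_i)_{i\ge1}$. For every $N$ let $(X_N(\sigma))_{\sigma\in\Sigma_N}$, $\Sigma_N=\{-1,+1\}^N$, be IID centered Gaussian variables of variance $N$, independent of $\vec h$, and put $$H_N(\sigma)=X_N(\sigma)+\sum_{i=1}^N h_i\sigma_i .$$ The equation $$\beta_c=\sqrt{2\big(\log 2-(\beta_c\,\mathbb E[h_1\tanh\beta_ch_1]-\mathbb E[\log\cosh\beta_ch_1])\big)}$$ has exactly one real solution $\beta_c$. Put $$E_{\max}=\beta_c+\mathbb E[h_1\tanh\beta_ch_1],\qquad C=\frac{1}{\sqrt{2\pi\big(1+\mathbb E[h_1^2/\cosh^2(\beta_ch_1)]\big)}} .$$ Then there are measurable functions $c_1=c_1(N,\vec h)$ and $c_2=c_2(N,\vec h)$ of the field such that, with $r(N,\vec h):=c_1N-c_2\log N$: (i) for $\mathbb P$-almost every $\vec h$, the conditional law given $\vec h$ of the point process $\sum_{\sigma\in\Sigma_N}\delta_{H_N(\sigma)-r(N,\vec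 h)}$ converges weakly as $N\to\infty$ (in the space of locally finite measures on $\mathbb R$ with the vague topology) to the law of a Poisson process on $\mathbb R$ with intensity $Ce^{-\beta_cz}\,dz$; (ii) $c_1(N,\vec h)\to E_{\max}$ and $c_2(N,\vec h)\to\frac1{2\beta_c}$ $\mathbb P$-almost surely; (iii) for $\mathbb P$-almost every $\vec h$ and every $z\in\mathbb R$, $$\mathbb P\Big(\max_{\sigma\in\Sigma_N}H_N(\sigma)-r(N,\vec h)\le z\,\Big|\,\vec h\Big)\to\exp\Big(-\frac{C}{\beta_c}e^{-\beta_cz}\Big),$$ that is, given $\vec h$ the maximum has Gumbel fluctuations around $r(N,\vec h)$. -/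

import Mathlib

open MeasureTheory ProbabilityTheory Filter Topology
open scoped ENNReal NNReal

noncomputable section

/-! ### Random measures on the line: vague topology and Poisson processes -/

/-- Locally finite (equivalently, Radon) Borel measures on `ℝ`: the state space of point
processes. -/
structure LocFinMeasure where
  /-- The underlying measure. -/
  toMeasure : Measure ℝ
  isLocallyFinite : IsLocallyFiniteMeasure toMeasure

namespace LocFinMeasure

/-- The vague topology: the coarsest one for which `ξ ↦ ∫ φ dξ` is continuous for every continuous
compactly supported `φ : ℝ → ℝ`. -/
instance : TopologicalSpace LocFinMeasure :=
  TopologicalSpace.induced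
    (fun (ξ : LocFinMeasure) (φ : CompactlySupportedContinuousMap ℝ ℝ) => ∫ x, φ x ∂ξ.toMeasure)
    Pi.topologicalSpace

/-- The Borel σ-algebra of the vague topology. -/
instance : MeasurableSpace LocFinMeasure := borel LocFinMeasure

instance : BorelSpace LocFinMeasure := ⟨rfl⟩

/-- The counting measure `∑ᵢ δ_{xᵢ}` of a finite family of points (with multiplicity). -/
def ofPoints {ι : Type*} [Fintype ι] (x : ι → ℝ) : LocFinMeasure where
  toMeasure := ∑ i, Measure.dirac (x i)
  isLocallyFinite := inferInstance

end LocFinMeasure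

/-- `η` is a Poisson process on `ℝ` with intensity measure `ν`: the number of points in a bounded
Borel set `A` is Poisson with mean `ν A`, and the numbers of points in pairwise disjoint bounded
Borel sets are independent. -/
structure IsPoissonProcess {Ω' : Type*} [MeasurableSpace Ω'] (ν : Measure ℝ)
    (η : Ω' → LocFinMeasure) (Q : Measure Ω') : Prop where
  aemeasurable : AEMeasurable η Q
  hasLaw_count : ∀ A : Set ℝ, MeasurableSet A → Bornology.IsBounded A →
    HasLaw (fun ω => (η ω).toMeasure A)
      ((poissonMeasure (ν A).toNNReal).map (fun n : ℕ => (n : ℝ≥0∞))) Q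
  indep_count : ∀ (n : ℕ) (A : Fin n → Set ℝ), (∀ j, MeasurableSet (A j)) →
    (∀ j, Bornology.IsBounded (A j)) → Pairwise (fun j k => Disjoint (A j) (A k)) →
    iIndepFun (fun j ω => (η ω).toMeasure (A j)) Q

/-! ### The random energy model in a random magnetic field -/

/-- The hypercube `Σ_N = {-1, +1}^N`. -/
abbrev Config (N : ℕ) : Type := Fin N → ℤˣ

/-- The standing assumptions of the model. The fields `h 0, h 1, …` are IID with all exponential
moments; for each `N` the energies `X N σ`, `σ ∈ Σ_N`, are IID centered Gaussians of variance `N`,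
independent of the field sequence. Nothing is assumed on the joint law of the `X N` for
different `N`. -/
structure IsREMInRandomField {Ω : Type*} [MeasurableSpace Ω] (P : Measure Ω)
    (h : ℕ → Ω → ℝ) (X : (N : ℕ) → Config N → Ω → ℝ) : Prop where
  measurable_field : ∀ i, Measurable (h i)
  identDistrib_field : ∀ i, IdentDistrib (h i) (h 0) P P
  indep_field : iIndepFun h P
  integrable_exp_field : ∀ t : ℝ, Integrable (fun ω => Real.exp (t * h 0 ω)) P
  measurable_rem : ∀ N σ, Measurable (X N σ)
  hasLaw_rem : ∀ N σ, HasLaw (X N σ) (gaussianReal 0 (N : ℝ≥0)) P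
  indep_rem : ∀ N, iIndepFun (X N) P
  indep_rem_field : ∀ N, IndepFun (fun ω σ => X N σ ω) (fun ω i => h i ω) P

section

variable {Ω : Type*} [MeasurableSpace Ω]

/-- The Hamiltonian `H_N(σ) = X_N(σ) + ∑_{i ≤ N} h_i σ_i`. -/
def hamiltonian (h : ℕ → Ω → ℝ) (X : (N : ℕ) → Config N → Ω → ℝ) (N : ℕ) (σ : Config N)
    (ω : Ω) : ℝ :=
  X N σ ω + ∑ i : Fin N, h i ω * ((σ i : ℤ) : ℝ)

/-- A regular version of the conditional law of the energies `(H_N(σ))_{σ ∈ Σ_N}` given the field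
sequence `(h_i)_i`, as a kernel in the value of the field sequence. -/
abbrev quenchedLaw (P : Measure Ω) [IsProbabilityMeasure P] (h : ℕ → Ω → ℝ)
    (X : (N : ℕ) → Config N → Ω → ℝ) (N : ℕ) : Kernel (ℕ → ℝ) (Config N → ℝ) :=
  condDistrib (fun ω σ => hamiltonian h X N σ ω) (fun ω i => h i ω) P

/-- The self-consistency equation for the critical inverse temperature. -/
def IsCriticalBeta (P : Measure Ω) (h : ℕ → Ω → ℝ) (β : ℝ) : Prop :=
  β = √(2 * (Real.log 2 - (β * ∫ ω, h 0 ω * Real.tanh (β * h 0 ω) ∂P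
    - ∫ ω, Real.log (Real.cosh (β * h 0 ω)) ∂P)))

/-- `E_max = β_c + 𝔼[h₁ tanh(β_c h₁)]`, as a function of `β = β_c`. -/
def maxEnergyDensity (P : Measure Ω) (h : ℕ → Ω → ℝ) (β : ℝ) : ℝ :=
  β + ∫ ω, h 0 ω * Real.tanh (β * h 0 ω) ∂P

/-- The constant `C = 1 / √(2π (1 + 𝔼[h₁² / cosh²(β_c h₁)]))`, as a function of `β = β_c`. -/
def extremalConst (P : Measure Ω) (h : ℕ → Ω → ℝ) (β : ℝ) : ℝ :=
  1 / √(2 * Real.pi * (1 + ∫ ω, h 0 ω ^ 2 / Real.cosh (β * h 0 ω) ^ 2 ∂P))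

end

/-- The measure `C e^{-β z} dz` on `ℝ`. -/
def expIntensity (C β : ℝ) : Measure ℝ :=
  volume.withDensity (fun z => ENNReal.ofReal (C * Real.exp (-β * z)))

/-- The recentering `r(N, h) = c₁(N, h) N - c₂(N, h) log N`, for a realization `f` of the field. -/
def recentering (c₁ c₂ : ℕ → (ℕ → ℝ) → ℝ) (N : ℕ) (f : ℕ → ℝ) : ℝ :=
  c₁ N f * N - c₂ N f * Real.log N

end

/-!
Fix a realization `f` of the field. The energies are then independent Gaussians of variance `N` with
means `S(σ) = ∑ᵢ fᵢ σᵢ`, a null array, so everything follows once the density of the mean number of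
levels near the recentering `r` converges, with a majorant that is integrable at `+∞`:
`ρ_N(r + z) → C e^{-β_c z}` (`IsTypicalField.tendsto_levelDensity` and
`IsTypicalField.eventually_levelDensity_le`).

Tilting by `e^{b y}` and Fourier inversion of the Gaussian give an exact formula
(`levelDensity_eq_integral`): an exponential prefactor times the integral of
`e^{-isδ} e^{-s²/2} ∏ᵢ ψ(s/√N; fᵢ)`, where `ψ` is the characteristic function of a centered tilted
spin. At a fixed `b = β_c` the mean of the tilted energies would in general miss `r` by a random
amount of order `√N`. Hence `b` is taken to be the critical inverse temperature of the empirical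
measure of the field (`empiricalBeta`), and `r` the mean tilted energy minus `log N / (2b)`. Then
the prefactor is `e^{-bz} / (2π)` and `δ → 0` (`levelDensity_tiltedLevel`). Since `|ψ| ≤ 1`, the
integral is dominated by a Gaussian, which yields both the limit and the majorant. The field enters
only through laws of large numbers at `β_c` and a fourth moment bound (`isTypicalField_of_tendsto`):
monotonicity of the entropy loss gives `empiricalBeta → β_c`, and the observables are Lipschitz in
the inverse temperature.

The Poisson limit theorem for null arrays (`tendsto_prod_one_add`) then gives
`𝔼 ∏_σ (1 + g(H(σ) - r)) → exp ∫ g(y) C e^{-β_c y} dy` for bounded `g` that vanish near `-∞`. With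
`g = e^{iφ} - 1` this is the convergence of characteristic functionals, with `g = -1_{(z, ∞)}` the
convergence of the law of the maximum.

Weak convergence for the vague topology follows from that of the characteristic functionals without
a tightness argument: the topology is induced by countably many test functions, open sets are
directed unions of cylinders, and Lévy's theorem applies to each cylinder
(`tendsto_probabilityMeasure_of_isInducing`). The limiting Poisson process is built from finite ones
on the cells `(n, n + 1]` and identified through its characteristic functional
(`isPoissonProcess_of_charFunctional`).
-/

noncomputable section

/-! ### Weak convergence through characteristic functionals -/

/-- Lévy's continuity theorem on a space whose topology is induced by countably many real functions:
no tightness is needed, since every open set is a directed union of open cylinders. -/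
theorem tendsto_probabilityMeasure_of_isInducing {E ι : Type*} [TopologicalSpace E]
    [MeasurableSpace E] [BorelSpace E] [Countable ι] (J : ι → E → ℝ)
    (hJ : IsInducing (fun (x : E) (i : ι) => J i x))
    {μ : ℕ → ProbabilityMeasure E} {μ₀ : ProbabilityMeasure E}
    (h : ∀ (I : Finset ι) (t : I → ℝ), Tendsto
      (fun n => ∫ x, Complex.exp ((∑ i, t i * J i x : ℝ) * Complex.I) ∂(μ n : Measure E)) atTop
      (𝓝 (∫ x, Complex.exp ((∑ i, t i * J i x : ℝ) * Complex.I) ∂(μ₀ : Measure E)))) :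
    Tendsto μ atTop (𝓝 μ₀) := by
  have hJc : ∀ i, Continuous (J i) := fun i => (continuous_apply i).comp hJ.continuous
  -- the finite-dimensional marginals converge by Lévy's theorem
  let p : (I : Finset ι) → E → EuclideanSpace ℝ I := fun I x => WithLp.toLp 2 fun i => J i x
  have hpc : ∀ I, Continuous (p I) := fun I => by fun_prop
  have hchar : ∀ (I : Finset ι) (ν : ProbabilityMeasure E) (t : EuclideanSpace ℝ I),
      charFun ((ν.map (hpc I).aemeasurable : ProbabilityMeasure _) : Measure _) t
        = ∫ x, Complex.exp ((∑ i, t i * J i x : ℝ) * Complex.I) ∂(ν : Measure E) := by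
    intro I ν t
    rw [ProbabilityMeasure.toMeasure_map, charFun_apply, integral_map (hpc I).aemeasurable]
    · simp [p, PiLp.inner_apply]
    · fun_prop
  have hfin : ∀ I, Tendsto (fun n => (μ n).map (hpc I).aemeasurable) atTop
      (𝓝 (μ₀.map (hpc I).aemeasurable)) := by
    intro I
    refine ProbabilityMeasure.tendsto_of_tendsto_charFun fun t => ?_
    simp_rw [hchar]
    exact h I _
  refine tendsto_of_forall_isOpen_le_liminf fun G hG => ?_
  -- the largest open cylinder over `I` inside `G`
  let W : (I : Finset ι) → Set (EuclideanSpace ℝ I) :=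
    fun I => ⋃₀ {W | IsOpen W ∧ p I ⁻¹' W ⊆ G}
  have hWo : ∀ I, IsOpen (W I) := fun I => isOpen_sUnion fun _ hW => hW.1
  have hWG : ∀ I, p I ⁻¹' W I ⊆ G := by
    rintro I x ⟨V, hV, hx⟩
    exact hV.2 hx
  have hmono : ∀ I I', I ⊆ I' → p I ⁻¹' W I ⊆ p I' ⁻¹' W I' := by
    intro I I' hI x hx
    let r : EuclideanSpace ℝ I' → EuclideanSpace ℝ I :=
      fun y => WithLp.toLp 2 fun i => y ⟨i, hI i.2⟩
    have hr : Continuous r := by fun_prop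
    have hrp : ∀ x, r (p I' x) = p I x := fun x => rfl
    refine Set.mem_sUnion.2 ⟨r ⁻¹' W I, ⟨(hWo I).preimage hr, ?_⟩, ?_⟩
    · intro y hy
      apply hWG I
      simpa [hrp] using hy
    · simpa [hrp] using hx
  have hunion : (⋃ I, p I ⁻¹' W I) = G := by
    refine Set.Subset.antisymm (Set.iUnion_subset hWG) fun x hx => ?_
    obtain ⟨V, hV, rfl⟩ := hJ.isOpen_iff.1 hG
    obtain ⟨I, u, hu, huV⟩ := isOpen_pi_iff.1 hV _ hx
    refine Set.mem_iUnion.2 ⟨I, Set.mem_sUnion.2 ⟨{y | ∀ i : I, y i ∈ u i}, ⟨?_, ?_⟩, ?_⟩⟩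
    · simp only [Set.ofPred_forall]
      exact isOpen_iInter_of_finite fun i => (hu i i.2).1.preimage (by fun_prop)
    · intro y hy
      exact huV fun i hi => hy ⟨i, hi⟩
    · exact fun i => (hu i i.2).2
  have hdir : Directed (· ⊆ ·) fun I => p I ⁻¹' W I := by
    classical
    exact fun I I' => ⟨I ∪ I', hmono _ _ Finset.subset_union_left,
      hmono _ _ Finset.subset_union_right⟩
  have hsup : (μ₀ : Measure E) G = ⨆ I, (μ₀ : Measure E) (p I ⁻¹' W I) := by
    rw [← hunion, hdir.measure_iUnion]
  have key : (μ₀ : Measure E) G ≤ liminf (fun n => (μ n : Measure E) G) atTop := by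
    rw [hsup]
    refine iSup_le fun I => ?_
    have h1 := ProbabilityMeasure.le_liminf_measure_open_of_tendsto (hfin I) (hWo I)
    simp only [ProbabilityMeasure.toMeasure_map] at h1
    rw [Measure.map_apply (hpc I).measurable (hWo I).measurableSet] at h1
    refine h1.trans (liminf_le_liminf (Eventually.of_forall fun n => ?_))
    rw [Measure.map_apply (hpc I).measurable (hWo I).measurableSet]
    exact measure_mono (hWG I)
  have hco : ∀ ν : ProbabilityMeasure E, ((ν G : ℝ≥0) : ℝ≥0∞) = (ν : Measure E) G := fun ν => by
    simp
  rw [← ENNReal.coe_le_coe, ENNReal.ofNNReal_liminf]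
  · simpa only [hco] using key
  · exact IsCoboundedUnder.of_frequently_le (a := 1)
      (Frequently.of_forall fun n => ProbabilityMeasure.apply_le_one _ _)

/-! ### The vague topology -/

namespace LocFinMeasure

open scoped CompactlySupported

instance (ξ : LocFinMeasure) : IsLocallyFiniteMeasure ξ.toMeasure := ξ.isLocallyFinite

theorem isInducing_integral :
    IsInducing (fun (ξ : LocFinMeasure) (φ : C_c(ℝ, ℝ)) => ∫ x, φ x ∂ξ.toMeasure) := ⟨rfl⟩

theorem continuous_integral (φ : C_c(ℝ, ℝ)) :
    Continuous fun ξ : LocFinMeasure => ∫ x, φ x ∂ξ.toMeasure :=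
  (continuous_apply φ).comp isInducing_integral.continuous

theorem integrable_coe (ξ : LocFinMeasure) (φ : C_c(ℝ, ℝ)) : Integrable φ ξ.toMeasure :=
  φ.continuous.integrable_of_hasCompactSupport φ.hasCompactSupport

/-- A continuous function on `ℝ` that vanishes outside `[-R, R]`, as an element of `C_c(ℝ, ℝ)`. -/
def ofVanishing (R : ℝ) (f : C(ℝ, ℝ)) (hf : ∀ x, R < |x| → f x = 0) : C_c(ℝ, ℝ) where
  toContinuousMap := f
  hasCompactSupport' := HasCompactSupport.intro (isCompact_Icc (a := -R) (b := R)) fun x hx => by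
    apply hf
    by_contra! h
    exact hx (abs_le.1 h)

/-- A trapezoidal function that equals `1` on `[-R, R]` and vanishes outside `[-R - 1, R + 1]`. -/
def plateau (R : ℝ) : C_c(ℝ, ℝ) :=
  ofVanishing (R + 1) ⟨fun x => max 0 (min 1 (R + 1 - |x|)), by fun_prop⟩ fun x hx => by
    simp only [ContinuousMap.coe_mk]
    rw [max_eq_left]
    exact (min_le_right _ _).trans (by linarith)

theorem plateau_apply (R x : ℝ) : plateau R x = max 0 (min 1 (R + 1 - |x|)) := rfl

theorem plateau_eq_one {R x : ℝ} (h : |x| ≤ R) : plateau R x = 1 := by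
  rw [plateau_apply, min_eq_left (by linarith), max_eq_right zero_le_one]

theorem plateau_nonneg (R x : ℝ) : 0 ≤ plateau R x := le_max_left _ _

/-- `C(ℝ, ℝ)` is second countable in the compact-open topology, so the functions that vanish
outside `[-R, R]` have a countable uniformly dense subset. -/
theorem exists_countable_dense_vanishing (R : ℝ) : ∃ D : Set C_c(ℝ, ℝ), D.Countable ∧
    (∀ ψ ∈ D, ∀ x, R < |x| → ψ x = 0) ∧
    ∀ φ : C_c(ℝ, ℝ), (∀ x, R < |x| → φ x = 0) → ∀ ε > 0, ∃ ψ ∈ D, ∀ x, |φ x - ψ x| ≤ ε := by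
  let V : Set C(ℝ, ℝ) := {f | ∀ x, R < |x| → f x = 0}
  obtain ⟨s, hs, hd⟩ := TopologicalSpace.exists_countable_dense V
  refine ⟨(fun f : V => ofVanishing R f.1 f.2) '' s, hs.image _, ?_, ?_⟩
  · rintro _ ⟨f, -, rfl⟩
    exact f.2
  · intro φ hφ ε hε
    let φ' : V := ⟨φ.toContinuousMap, hφ⟩
    obtain ⟨u, hu, hlim⟩ := mem_closure_iff_seq_limit.1 (hd φ')
    have h1 : Tendsto (fun n => (u n).1) atTop (𝓝 φ'.1) :=
      (continuous_subtype_val.tendsto _).comp hlim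
    have h2 := ContinuousMap.tendsto_iff_forall_isCompact_tendstoUniformlyOn.1 h1
      (Set.Icc (-R) R) isCompact_Icc
    obtain ⟨n, hn⟩ := (Metric.tendstoUniformlyOn_iff.1 h2 ε hε).exists
    refine ⟨_, ⟨u n, hu n, rfl⟩, fun x => ?_⟩
    by_cases hx : |x| ≤ R
    · exact (hn x (abs_le.1 hx)).le
    · have e1 : φ x = 0 := hφ x (not_le.1 hx)
      have e2 : ofVanishing R (u n).1 (u n).2 x = 0 := (u n).2 x (not_le.1 hx)
      rw [e1, e2]
      simpa using hε.le

theorem exists_vanishing (φ : C_c(ℝ, ℝ)) : ∃ R : ℕ, ∀ x, (R : ℝ) < |x| → φ x = 0 := by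
  obtain ⟨r, hr⟩ := φ.hasCompactSupport.isBounded.subset_closedBall 0
  obtain ⟨R, hR⟩ := exists_nat_ge r
  refine ⟨R, fun x hx => image_eq_zero_of_notMem_tsupport fun hx' => ?_⟩
  have := hr hx'
  rw [mem_closedBall_zero_iff, Real.norm_eq_abs] at this
  linarith

/-- Countably many test functions induce the vague topology. -/
theorem exists_countable_isInducing : ∃ D : Set C_c(ℝ, ℝ), D.Countable ∧
    IsInducing (fun (ξ : LocFinMeasure) (φ : D) => ∫ x, φ.1 x ∂ξ.toMeasure) := by
  choose D hDc hDv hDd using fun R : ℕ => exists_countable_dense_vanishing (R : ℝ)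
  let D' : Set C_c(ℝ, ℝ) := (⋃ R, D R) ∪ Set.range fun R : ℕ => plateau R
  refine ⟨D', (Set.countable_iUnion hDc).union (Set.countable_range _), ?_⟩
  set J := fun (ξ : LocFinMeasure) (φ : D') => ∫ x, φ.1 x ∂ξ.toMeasure with hJ
  have hle : (inferInstance : TopologicalSpace LocFinMeasure) ≤
      TopologicalSpace.induced J inferInstance :=
    continuous_iff_le_induced.1 (continuous_pi fun φ => continuous_integral φ.1)
  refine ⟨le_antisymm hle ?_⟩
  refine continuous_iff_le_induced.1
    (@continuous_pi _ _ _ (TopologicalSpace.induced J inferInstance) _ _ fun φ => ?_)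
  let t : TopologicalSpace LocFinMeasure := TopologicalSpace.induced J inferInstance
  change Continuous[t, _] fun ξ : LocFinMeasure => ∫ x, φ x ∂ξ.toMeasure
  have hcJ : Continuous[t, _] J := continuous_induced_dom
  have hc : ∀ ψ ∈ D', Continuous[t, _] fun ξ : LocFinMeasure => ∫ x, ψ x ∂ξ.toMeasure :=
    fun ψ hψ => (continuous_apply (⟨ψ, hψ⟩ : D')).comp hcJ
  obtain ⟨R, hR⟩ := exists_vanishing φ
  refine continuous_of_locally_uniform_approx_of_continuousAt fun ξ₀ u hu => ?_
  obtain ⟨ε, hε, hεu⟩ := Metric.mem_uniformity_dist.1 hu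
  -- approximating `φ` within `δ` changes its integral by at most `δ ∫ χ`, with `χ` a plateau
  set M := ∫ x, plateau R x ∂ξ₀.toMeasure + 1 with hM
  have hM0 : 0 < M := by
    have : 0 ≤ ∫ x, plateau R x ∂ξ₀.toMeasure := integral_nonneg (plateau_nonneg R)
    linarith
  obtain ⟨ψ, hψ, hψφ⟩ := hDd R φ hR (ε / (2 * M)) (by positivity)
  have hpl : Continuous[t, _] fun ξ : LocFinMeasure => ∫ x, plateau R x ∂ξ.toMeasure :=
    hc _ (Or.inr ⟨R, rfl⟩)
  refine ⟨{ξ | ∫ x, plateau R x ∂ξ.toMeasure < M}, ?_, fun ξ => ∫ x, ψ x ∂ξ.toMeasure, ?_, ?_⟩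
  · exact (isOpen_lt hpl continuous_const).mem_nhds (by simp [hM])
  · exact (hc ψ (Or.inl (Set.mem_iUnion.2 ⟨R, hψ⟩))).continuousAt
  · intro ξ hξ
    apply hεu
    rw [Real.dist_eq, ← integral_sub (integrable_coe ξ φ) (integrable_coe ξ ψ)]
    have hb : ∀ x, ‖φ x - ψ x‖ ≤ ε / (2 * M) * plateau R x := by
      intro x
      by_cases hx : |x| ≤ R
      · rw [plateau_eq_one hx, mul_one]
        exact hψφ x
      · rw [hR x (not_le.1 hx), hDv R ψ hψ x (not_le.1 hx)]
        simp only [sub_self, norm_zero]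
        exact mul_nonneg (by positivity) (plateau_nonneg _ _)
    calc |∫ x, φ x - ψ x ∂ξ.toMeasure| ≤ ∫ x, ε / (2 * M) * plateau R x ∂ξ.toMeasure :=
          norm_integral_le_of_norm_le ((integrable_coe ξ _).const_mul _) (ae_of_all _ hb)
      _ = ε / (2 * M) * ∫ x, plateau R x ∂ξ.toMeasure := integral_const_mul _ _
      _ ≤ ε / (2 * M) * M := by
          have : ∫ x, plateau R x ∂ξ.toMeasure ≤ M := le_of_lt hξ
          gcongr
      _ < ε := by
          field_simp
          linarith

/-- A map into `LocFinMeasure` is Borel as soon as its integrals of test functions are. -/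
theorem measurable_of_integral {Y : Type*} [MeasurableSpace Y] {T : Y → LocFinMeasure}
    (hT : ∀ φ : C_c(ℝ, ℝ), Measurable fun y => ∫ x, φ x ∂(T y).toMeasure) : Measurable T := by
  obtain ⟨D, hDc, hD⟩ := exists_countable_isInducing
  have : Countable D := hDc.to_subtype
  set J := fun (ξ : LocFinMeasure) (φ : D) => ∫ x, φ.1 x ∂ξ.toMeasure with hJ
  have e : borel LocFinMeasure = MeasurableSpace.comap J inferInstance := by
    rw [BorelSpace.measurable_eq (α := (D → ℝ)), ← borel_comap, ← hD.eq_induced]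
  have h1 : @Measurable _ _ _ (MeasurableSpace.comap J inferInstance) T :=
    measurable_comap_iff.2 (measurable_pi_lambda _ fun φ => hT φ.1)
  rw [← e] at h1
  exact h1

/-- Weak convergence of random measures follows from that of characteristic functionals. -/
theorem tendsto_of_tendsto_charFunctional {μ : ℕ → ProbabilityMeasure LocFinMeasure}
    {μ₀ : ProbabilityMeasure LocFinMeasure}
    (h : ∀ φ : C_c(ℝ, ℝ), Tendsto
      (fun n => ∫ ξ, Complex.exp ((∫ x, φ x ∂ξ.toMeasure : ℝ) * Complex.I)
        ∂(μ n : Measure LocFinMeasure)) atTop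
      (𝓝 (∫ ξ, Complex.exp ((∫ x, φ x ∂ξ.toMeasure : ℝ) * Complex.I)
        ∂(μ₀ : Measure LocFinMeasure)))) :
    Tendsto μ atTop (𝓝 μ₀) := by
  obtain ⟨D, hDc, hD⟩ := exists_countable_isInducing
  have : Countable D := hDc.to_subtype
  refine tendsto_probabilityMeasure_of_isInducing
    (fun (φ : D) (ξ : LocFinMeasure) => ∫ x, φ.1 x ∂ξ.toMeasure) hD fun I t => ?_
  have e : ∀ ξ : LocFinMeasure, (∑ i, t i * ∫ x, i.1.1 x ∂ξ.toMeasure)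
      = ∫ x, (∑ i, t i • i.1.1 : C_c(ℝ, ℝ)) x ∂ξ.toMeasure := by
    intro ξ
    simp only [CompactlySupportedContinuousMap.coe_sum, Finset.sum_apply,
      CompactlySupportedContinuousMap.coe_smul, Pi.smul_apply, smul_eq_mul]
    rw [integral_finsetSum _ fun i _ => (integrable_coe ξ _).const_mul _]
    simp_rw [integral_const_mul]
  simp_rw [e]
  exact h _

/-! ### Measurability of evaluations and integrals -/

theorem measurable_apply_Ioo (a b : ℝ) :
    Measurable fun ξ : LocFinMeasure => ξ.toMeasure (Set.Ioo a b) := by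
  let φ : ℕ → C_c(ℝ, ℝ) := fun n => ofVanishing (max |a| |b|)
    ⟨fun x => max 0 (min 1 (n * min (x - a) (b - x))), by fun_prop⟩ fun x hx => by
      simp only [ContinuousMap.coe_mk]
      refine max_eq_left ((min_le_right _ _).trans
        (mul_nonpos_of_nonneg_of_nonpos n.cast_nonneg ?_))
      by_contra! h
      obtain ⟨h1, h2⟩ := lt_min_iff.1 h
      exact hx.not_ge (abs_le_max_abs_abs (by linarith) (by linarith))
  have hφ : ∀ n x, φ n x = max 0 (min 1 (n * min (x - a) (b - x))) := fun n x => rfl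
  have hlim : Measurable fun ξ : LocFinMeasure => ξ.toMeasure.real (Set.Ioo a b) := by
    refine measurable_of_tendsto_metrizable (fun n => (continuous_integral (φ n)).measurable) ?_
    refine tendsto_pi_nhds.2 fun ξ => ?_
    rw [← integral_indicator_one measurableSet_Ioo]
    refine tendsto_integral_of_dominated_convergence ((Set.Ioo a b).indicator 1)
      (fun n => (φ n).continuous.aestronglyMeasurable) ?_ (fun n => ae_of_all _ fun x => ?_)
      (ae_of_all _ fun x => ?_)
    · rw [integrable_indicator_iff measurableSet_Ioo]
      exact integrableOn_const (measure_Ioo_lt_top.ne)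
    · rw [Real.norm_eq_abs, hφ, abs_of_nonneg (le_max_left _ _)]
      by_cases hx : x ∈ Set.Ioo a b
      · simp [hx]
      · rw [Set.indicator_of_notMem hx]
        refine max_le le_rfl ((min_le_right _ _).trans
          (mul_nonpos_of_nonneg_of_nonpos n.cast_nonneg ?_))
        by_contra! h
        obtain ⟨h1, h2⟩ := lt_min_iff.1 h
        exact hx ⟨by linarith, by linarith⟩
    · by_cases hx : x ∈ Set.Ioo a b
      · have hm : 0 < min (x - a) (b - x) := lt_min (by linarith [hx.1]) (by linarith [hx.2])
        obtain ⟨n₀, hn₀⟩ := exists_nat_gt (1 / min (x - a) (b - x))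
        refine tendsto_const_nhds.congr' ?_
        filter_upwards [eventually_ge_atTop n₀] with n hn
        have h1 : 1 ≤ n * min (x - a) (b - x) := by
          rw [div_lt_iff₀ hm] at hn₀
          have : (n₀ : ℝ) ≤ n := by exact_mod_cast hn
          nlinarith
        rw [hφ, min_eq_left h1]
        simp [hx]
      · refine tendsto_const_nhds.congr fun n => ?_
        rw [hφ, Set.indicator_of_notMem hx, max_eq_left]
        refine (min_le_right _ _).trans (mul_nonpos_of_nonneg_of_nonpos n.cast_nonneg ?_)
        by_contra! h
        obtain ⟨h1, h2⟩ := lt_min_iff.1 h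
        exact hx ⟨by linarith, by linarith⟩
  have e : (fun ξ : LocFinMeasure => ξ.toMeasure (Set.Ioo a b))
      = fun ξ => ENNReal.ofReal (ξ.toMeasure.real (Set.Ioo a b)) := by
    funext ξ
    rw [ofReal_measureReal measure_Ioo_lt_top.ne]
  rw [e]
  exact hlim.ennreal_ofReal

theorem measurable_toMeasure : Measurable LocFinMeasure.toMeasure := by
  have hres : ∀ n : ℕ, Measurable fun ξ : LocFinMeasure =>
      ξ.toMeasure.restrict (Set.Ioo (-n : ℝ) n) := by
    intro n
    have : ∀ ξ : LocFinMeasure, IsFiniteMeasure (ξ.toMeasure.restrict (Set.Ioo (-n : ℝ) n)) :=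
      fun ξ => ⟨by simpa using measure_Ioo_lt_top⟩
    refine Measurable.measure_of_isPiSystem
      ((BorelSpace.measurable_eq (α := ℝ)).trans Real.borel_eq_generateFrom_Ioo_rat)
      Real.isPiSystem_Ioo_rat ?_ ?_
    · intro s hs
      simp only [Set.mem_iUnion, Set.mem_singleton_iff] at hs
      obtain ⟨a, b, -, rfl⟩ := hs
      simp only [Measure.restrict_apply measurableSet_Ioo, Set.Ioo_inter_Ioo]
      exact measurable_apply_Ioo _ _
    · simp only [Measure.restrict_apply MeasurableSet.univ, Set.univ_inter]
      exact measurable_apply_Ioo _ _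
  refine Measure.measurable_of_measurable_coe _ fun A hA => ?_
  have e : (fun ξ : LocFinMeasure => ξ.toMeasure A)
      = fun ξ => ⨆ n : ℕ, ξ.toMeasure.restrict (Set.Ioo (-n : ℝ) n) A := by
    funext ξ
    simp_rw [Measure.restrict_apply hA]
    rw [← Monotone.measure_iUnion, ← Set.inter_iUnion]
    · congr 1
      symm
      rw [Set.inter_eq_left]
      intro x _
      obtain ⟨n, hn⟩ := exists_nat_gt |x|
      exact Set.mem_iUnion.2 ⟨n, abs_lt.1 hn⟩
    · intro m n hmn
      have : (m : ℝ) ≤ n := by exact_mod_cast hmn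
      exact Set.inter_subset_inter_right _ (Set.Ioo_subset_Ioo (by linarith) this)
  rw [e]
  exact Measurable.iSup fun n => (Measure.measurable_coe hA).comp (hres n)

theorem measurable_integral {g : ℝ → ℝ} (hg : Measurable g)
    (hint : ∀ ξ : LocFinMeasure, Integrable g ξ.toMeasure) :
    Measurable fun ξ : LocFinMeasure => ∫ x, g x ∂ξ.toMeasure := by
  simp_rw [integral_eq_lintegral_pos_part_sub_lintegral_neg_part (hint _)]
  exact ((Measure.measurable_lintegral (by fun_prop)).comp measurable_toMeasure).ennreal_toReal.sub
    ((Measure.measurable_lintegral (by fun_prop)).comp measurable_toMeasure).ennreal_toReal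

theorem integral_ofPoints {ι E : Type*} [Fintype ι] [NormedAddCommGroup E] [NormedSpace ℝ E]
    [CompleteSpace E] (x : ι → ℝ) (g : ℝ → E) :
    ∫ y, g y ∂(ofPoints x).toMeasure = ∑ i, g (x i) := by
  simp only [ofPoints]
  rw [integral_finsetSum_measure fun i _ => integrable_dirac (by simp)]
  simp

theorem measurable_ofPoints {ι : Type*} [Fintype ι] :
    Measurable (ofPoints : (ι → ℝ) → LocFinMeasure) := by
  refine measurable_of_integral fun φ => ?_
  simp_rw [integral_ofPoints]
  fun_prop

end LocFinMeasure

/-- Bounded Borel functions with bounded support. -/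
structure IsBoundedTest (g : ℝ → ℝ) : Prop where
  measurable : Measurable g
  bounded : ∃ B, ∀ x, |g x| ≤ B
  vanishing : ∃ R : ℕ, ∀ x, (R : ℝ) < |x| → g x = 0

theorem integrable_of_bounded_of_vanishing {E : Type*} [NormedAddCommGroup E] {g : ℝ → E}
    (hg : StronglyMeasurable g) {B R : ℝ} (hB : ∀ x, ‖g x‖ ≤ B) (hR : ∀ x, R < |x| → g x = 0)
    (ν : Measure ℝ) [IsLocallyFiniteMeasure ν] : Integrable g ν := by
  have h1 : IntegrableOn g (Set.Icc (-R) R) ν :=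
    Measure.integrableOn_of_bounded (M := B) measure_Icc_lt_top.ne hg.aestronglyMeasurable
      (ae_of_all _ hB)
  refine (integrableOn_iff_integrable_of_support_subset fun x hx => ?_).1 h1
  by_contra h
  refine hx (hR x ?_)
  by_contra! h'
  exact h (abs_le.1 h')

namespace IsBoundedTest

variable {g : ℝ → ℝ}

theorem integrable (hg : IsBoundedTest g) (ν : Measure ℝ) [IsLocallyFiniteMeasure ν] :
    Integrable g ν := by
  obtain ⟨B, hB⟩ := hg.bounded
  obtain ⟨R, hR⟩ := hg.vanishing
  exact integrable_of_bounded_of_vanishing hg.measurable.stronglyMeasurable hB hR ν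

theorem integrable_cexp_sub_one (hg : IsBoundedTest g) (ν : Measure ℝ)
    [IsLocallyFiniteMeasure ν] :
    Integrable (fun x => Complex.exp (g x * Complex.I) - 1) ν := by
  obtain ⟨R, hR⟩ := hg.vanishing
  have hm := hg.measurable
  refine integrable_of_bounded_of_vanishing (B := 2) (R := R)
    (Measurable.stronglyMeasurable (by fun_prop)) (fun x => ?_) (fun x hx => ?_) ν
  · refine (norm_sub_le _ _).trans ?_
    rw [Complex.norm_exp_ofReal_mul_I]
    norm_num
  · simp [hR x hx]

theorem indicator (hg : IsBoundedTest g) {s : Set ℝ} (hs : MeasurableSet s) :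
    IsBoundedTest (s.indicator g) where
  measurable := hg.measurable.indicator hs
  bounded := by
    obtain ⟨B, hB⟩ := hg.bounded
    refine ⟨B, fun x => ?_⟩
    by_cases hx : x ∈ s
    · simpa [hx] using hB x
    · simpa [hx] using (abs_nonneg _).trans (hB x)
  vanishing := by
    obtain ⟨R, hR⟩ := hg.vanishing
    refine ⟨R, fun x hx => ?_⟩
    simp [hR x hx]

theorem of_compactlySupported (φ : CompactlySupportedContinuousMap ℝ ℝ) : IsBoundedTest φ where
  measurable := φ.continuous.measurable
  bounded := by
    obtain ⟨B, hB⟩ := φ.hasCompactSupport.exists_bound_of_continuous φ.continuous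
    exact ⟨B, hB⟩
  vanishing := LocFinMeasure.exists_vanishing φ

theorem measurable_integral (hg : IsBoundedTest g) :
    Measurable fun ξ : LocFinMeasure => ∫ x, g x ∂ξ.toMeasure :=
  LocFinMeasure.measurable_integral hg.measurable fun _ => hg.integrable _

end IsBoundedTest

/-! ### Poisson processes with finite intensity measure -/

/-- The Poisson process with finite intensity measure `ν`: a Poisson number of independent points
with law `ν / ν(ℝ)`, written without the normalization, as `e^{-ν(ℝ)} ∑ₖ ν^{⊗k} / k!`. -/
def finitePoisson (ν : Measure ℝ) : Measure LocFinMeasure :=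
  Measure.sum fun k : ℕ => ENNReal.ofReal (Real.exp (-ν.real Set.univ) / k.factorial) •
    (Measure.pi fun _ : Fin k => ν).map LocFinMeasure.ofPoints

instance isProbabilityMeasure_finitePoisson (ν : Measure ℝ) [IsFiniteMeasure ν] :
    IsProbabilityMeasure (finitePoisson ν) := by
  constructor
  rw [finitePoisson, Measure.sum_apply _ MeasurableSet.univ]
  have e : ∀ k : ℕ, (ENNReal.ofReal (Real.exp (-ν.real Set.univ) / k.factorial) •
      (Measure.pi fun _ : Fin k => ν).map LocFinMeasure.ofPoints) Set.univ
      = ENNReal.ofReal (Real.exp (-ν.real Set.univ) *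
          (ν.real Set.univ ^ k / k.factorial)) := by
    intro k
    rw [Measure.smul_apply, Measure.map_apply LocFinMeasure.measurable_ofPoints MeasurableSet.univ,
      Set.preimage_univ, Measure.pi_univ, Finset.prod_const, Finset.card_univ, Fintype.card_fin,
      smul_eq_mul, ← ofReal_measureReal (measure_ne_top ν _), ← ENNReal.ofReal_pow (by positivity),
      ← ENNReal.ofReal_mul (by positivity)]
    congr 1
    ring
  simp_rw [e]
  have hs := (NormedSpace.expSeries_div_hasSum_exp (ν.real Set.univ)).mul_left
    (Real.exp (-ν.real Set.univ))
  rw [← ENNReal.ofReal_tsum_of_nonneg (fun n => by positivity) hs.summable, hs.tsum_eq,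
    ← Real.exp_eq_exp_ℝ, ← Real.exp_add]
  simp

/-- Given the number `k` of points, the characteristic functional is a `k`-th power; summing over
`k` gives an exponential series. -/
theorem charFunctional_finitePoisson (ν : Measure ℝ) [IsFiniteMeasure ν] {g : ℝ → ℝ}
    (hg : IsBoundedTest g) :
    ∫ ξ, Complex.exp ((∫ x, g x ∂ξ.toMeasure : ℝ) * Complex.I) ∂finitePoisson ν
      = Complex.exp (∫ x, (Complex.exp (g x * Complex.I) - 1) ∂ν) := by
  have hm := hg.measurable
  have hmI := hg.measurable_integral
  have hF : Measurable fun ξ : LocFinMeasure =>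
    Complex.exp ((∫ x, g x ∂ξ.toMeasure : ℝ) * Complex.I) := by fun_prop
  have hint : Integrable (fun ξ : LocFinMeasure =>
      Complex.exp ((∫ x, g x ∂ξ.toMeasure : ℝ) * Complex.I)) (finitePoisson ν) :=
    Integrable.of_bound hF.aestronglyMeasurable 1
      (ae_of_all _ fun ξ => (Complex.norm_exp_ofReal_mul_I _).le)
  have hterm : ∀ k : ℕ, ∫ ξ, Complex.exp ((∫ x, g x ∂ξ.toMeasure : ℝ) * Complex.I)
      ∂(ENNReal.ofReal (Real.exp (-ν.real Set.univ) / k.factorial) •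
        (Measure.pi fun _ : Fin k => ν).map LocFinMeasure.ofPoints)
      = Complex.exp (-ν.real Set.univ) *
        ((∫ x, Complex.exp (g x * Complex.I) ∂ν) ^ k / k.factorial) := by
    intro k
    rw [integral_smul_measure, integral_map LocFinMeasure.measurable_ofPoints.aemeasurable
      hF.aestronglyMeasurable, ENNReal.toReal_ofReal (by positivity)]
    simp_rw [LocFinMeasure.integral_ofPoints, Complex.ofReal_sum, Finset.sum_mul, Complex.exp_sum]
    rw [integral_fintype_prod_eq_pow (fun x : ℝ => Complex.exp (g x * Complex.I)),
      Fintype.card_fin, Complex.real_smul]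
    push_cast
    ring
  have h1 := hasSum_integral_measure hint
  simp_rw [hterm] at h1
  have h2 := (NormedSpace.expSeries_div_hasSum_exp
    (∫ x, Complex.exp (g x * Complex.I) ∂ν)).mul_left (Complex.exp (-ν.real Set.univ))
  rw [finitePoisson, h1.unique h2, ← Complex.exp_eq_exp_ℂ, ← Complex.exp_add,
    integral_sub _ (integrable_const _)]
  · congr 1
    simp
    ring
  · exact Integrable.of_bound (Measurable.aestronglyMeasurable (by fun_prop)) 1
      (ae_of_all _ fun ξ => (Complex.norm_exp_ofReal_mul_I _).le)

/-! ### Poisson processes with locally finite intensity measure -/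

/-- The unit interval `(n, n + 1]`. -/
abbrev cell (n : ℤ) : Set ℝ := Set.Ioc (n : ℝ) (n + 1)

theorem mem_cell_of_abs_le {R : ℕ} {x : ℝ} (hx : |x| ≤ R) :
    ∃ n ∈ Finset.Ico (-(R : ℤ) - 1) R, x ∈ cell n := by
  obtain ⟨h1, h2⟩ := abs_le.1 hx
  refine ⟨⌈x⌉ - 1, ?_, ?_, ?_⟩
  · rw [Finset.mem_Ico]
    have h3 : ⌈x⌉ ≤ (R : ℤ) := Int.ceil_le.2 (by exact_mod_cast h2)
    have h4 : -(R : ℤ) ≤ ⌈x⌉ := by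
      have := Int.le_ceil x
      have h5 : ((-(R : ℤ) : ℤ) : ℝ) ≤ (⌈x⌉ : ℝ) := by push_cast; linarith
      exact_mod_cast h5
    omega
  · push_cast
    linarith [Int.ceil_lt_add_one x]
  · push_cast
    linarith [Int.le_ceil x]

theorem disjoint_cell {m n : ℤ} (h : m ≠ n) : Disjoint (cell m) (cell n) :=
  Set.pairwise_disjoint_Ioc_intCast ℝ h

theorem sum_integral_cell {E : Type*} [NormedAddCommGroup E] [NormedSpace ℝ E] {g : ℝ → E}
    {ν : Measure ℝ} (hg : Integrable g ν) {R : ℕ} (hR : ∀ x, (R : ℝ) < |x| → g x = 0) :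
    ∑ n ∈ Finset.Ico (-(R : ℤ) - 1) R, ∫ x in cell n, g x ∂ν = ∫ x, g x ∂ν := by
  rw [← integral_biUnion_finset _ (fun n _ => measurableSet_Ioc)
    (fun m _ n _ h => disjoint_cell h) fun n _ => hg.integrableOn]
  refine setIntegral_eq_integral_of_forall_compl_eq_zero fun x hx => hR x ?_
  by_contra! h
  obtain ⟨n, hn, hxn⟩ := mem_cell_of_abs_le h
  exact hx (Set.mem_biUnion hn hxn)

/-- The superposition of the restrictions of `ξ n` to the cells `(n, n + 1]`. -/
def superpose (ξ : ℤ → LocFinMeasure) : LocFinMeasure where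
  toMeasure := Measure.sum fun n => (ξ n).toMeasure.restrict (cell n)
  isLocallyFinite := by
    refine ⟨fun x => ?_⟩
    obtain ⟨R, hR⟩ := exists_nat_gt |x|
    refine ⟨Set.Ioo (-R : ℝ) R, Ioo_mem_nhds (abs_lt.1 hR).1 (abs_lt.1 hR).2, ?_⟩
    rw [Measure.sum_apply _ measurableSet_Ioo, tsum_eq_sum (s := Finset.Ico (-(R : ℤ) - 1) R)]
    · refine ENNReal.sum_lt_top.2 fun n _ => ?_
      exact (Measure.restrict_apply_le _ _).trans_lt measure_Ioo_lt_top
    · intro n hn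
      rw [Measure.restrict_apply measurableSet_Ioo]
      convert measure_empty (μ := (ξ n).toMeasure)
      rw [← Set.disjoint_iff_inter_eq_empty, Set.disjoint_left]
      intro y hy hyn
      obtain ⟨m, hm, hym⟩ := mem_cell_of_abs_le (abs_le.2 ⟨hy.1.le, hy.2.le⟩)
      have : m ≠ n := fun h => hn (h ▸ hm)
      exact Set.disjoint_left.1 (disjoint_cell this) hym hyn

theorem restrict_superpose (ξ : ℤ → LocFinMeasure) (n : ℤ) :
    (superpose ξ).toMeasure.restrict (cell n) = (ξ n).toMeasure.restrict (cell n) := by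
  simp only [superpose]
  rw [Measure.restrict_sum _ measurableSet_Ioc]
  ext A hA
  rw [Measure.sum_apply _ hA, tsum_eq_single n]
  · rw [Measure.restrict_restrict measurableSet_Ioc, Set.inter_self]
  · intro m hm
    rw [Measure.restrict_restrict measurableSet_Ioc,
      Set.disjoint_iff_inter_eq_empty.1 (disjoint_cell hm.symm)]
    simp

theorem integral_superpose {g : ℝ → ℝ} (hg : IsBoundedTest g) {R : ℕ}
    (hR : ∀ x, (R : ℝ) < |x| → g x = 0) (ξ : ℤ → LocFinMeasure) :
    ∫ x, g x ∂(superpose ξ).toMeasure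
      = ∑ n ∈ Finset.Ico (-(R : ℤ) - 1) R, ∫ x, (cell n).indicator g x ∂(ξ n).toMeasure := by
  rw [← sum_integral_cell (hg.integrable _) hR]
  refine Finset.sum_congr rfl fun n _ => ?_
  rw [restrict_superpose, integral_indicator measurableSet_Ioc]

theorem measurable_superpose : Measurable superpose := by
  refine LocFinMeasure.measurable_of_integral fun φ => ?_
  have hφ := IsBoundedTest.of_compactlySupported φ
  obtain ⟨R, hR⟩ := hφ.vanishing
  simp_rw [integral_superpose hφ hR]
  exact Finset.measurable_fun_sum _ fun n _ =>
    (hφ.indicator measurableSet_Ioc).measurable_integral.comp (measurable_pi_apply n)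

/-- The law of the Poisson process with locally finite intensity measure `ν`, obtained by
superposing independent Poisson processes on the cells `(n, n + 1]`. -/
def poissonLaw (ν : Measure ℝ) [IsLocallyFiniteMeasure ν] : Measure LocFinMeasure :=
  (Measure.infinitePi fun n : ℤ => finitePoisson (ν.restrict (cell n))).map superpose

instance isFiniteMeasure_restrict_cell (ν : Measure ℝ) [IsLocallyFiniteMeasure ν] (n : ℤ) :
    IsFiniteMeasure (ν.restrict (cell n)) :=
  ⟨by simpa using measure_Ioc_lt_top⟩

instance isProbabilityMeasure_poissonLaw (ν : Measure ℝ) [IsLocallyFiniteMeasure ν] :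
    IsProbabilityMeasure (poissonLaw ν) :=
  Measure.isProbabilityMeasure_map measurable_superpose.aemeasurable

theorem charFunctional_poissonLaw (ν : Measure ℝ) [IsLocallyFiniteMeasure ν] {g : ℝ → ℝ}
    (hg : IsBoundedTest g) :
    ∫ ξ, Complex.exp ((∫ x, g x ∂ξ.toMeasure : ℝ) * Complex.I) ∂poissonLaw ν
      = Complex.exp (∫ x, (Complex.exp (g x * Complex.I) - 1) ∂ν) := by
  obtain ⟨R, hR⟩ := hg.vanishing
  have hmI := hg.measurable_integral
  set s := Finset.Ico (-(R : ℤ) - 1) R with hs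
  have hgn : ∀ n, IsBoundedTest ((cell n).indicator g) := fun n => hg.indicator measurableSet_Ioc
  have hmn : ∀ n, Measurable fun ξ : LocFinMeasure =>
      ∫ x, (cell n).indicator g x ∂ξ.toMeasure := fun n => (hgn n).measurable_integral
  rw [poissonLaw, integral_map measurable_superpose.aemeasurable
    (Measurable.aestronglyMeasurable (by fun_prop))]
  have e : ∀ ξ : ℤ → LocFinMeasure,
      Complex.exp ((∫ x, g x ∂(superpose ξ).toMeasure : ℝ) * Complex.I) = ∏ n : s, Complex.exp
        ((∫ x, (cell n).indicator g x ∂(ξ n).toMeasure : ℝ) * Complex.I) := by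
    intro ξ
    rw [integral_superpose hg hR, Complex.ofReal_sum, Finset.sum_mul, Complex.exp_sum,
      ← Finset.prod_coe_sort]
  simp_rw [e]
  have h1 := integral_restrict_infinitePi
    (fun n : ℤ => finitePoisson (ν.restrict (cell n))) (s := s)
    (f := fun ξ => ∏ n : s, Complex.exp
      ((∫ x, (cell n).indicator g x ∂(ξ n).toMeasure : ℝ) * Complex.I))
    (Measurable.aestronglyMeasurable (Finset.measurable_fun_prod _ fun n _ => by
      have := (hmn n).comp (measurable_pi_apply (X := fun _ : s => LocFinMeasure) n)
      exact Complex.measurable_exp.comp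
        ((Complex.measurable_ofReal.comp this).mul_const Complex.I)))
  refine h1.trans ?_
  rw [integral_fintype_prod_eq_prod (fun (n : s) (ξ : LocFinMeasure) => Complex.exp
      ((∫ x, (cell n).indicator g x ∂ξ.toMeasure : ℝ) * Complex.I))]
  simp_rw [charFunctional_finitePoisson _ (hgn _)]
  rw [← Complex.exp_sum, Finset.sum_coe_sort s (fun n => ∫ x,
    (Complex.exp ((cell n).indicator g x * Complex.I) - 1) ∂ν.restrict (cell n))]
  congr 1
  rw [← sum_integral_cell (hg.integrable_cexp_sub_one ν) (R := R) fun x hx => by simp [hR x hx]]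
  refine Finset.sum_congr rfl fun n _ => setIntegral_congr_fun measurableSet_Ioc fun x hx => ?_
  simp [Set.indicator_of_mem hx]

/-- A random measure with the characteristic functional of a Poisson process is one. -/
theorem isPoissonProcess_of_charFunctional (ν : Measure ℝ) [IsLocallyFiniteMeasure ν]
    (Q : Measure LocFinMeasure) [IsProbabilityMeasure Q]
    (h : ∀ g, IsBoundedTest g →
      ∫ ξ, Complex.exp ((∫ x, g x ∂ξ.toMeasure : ℝ) * Complex.I) ∂Q
        = Complex.exp (∫ x, (Complex.exp (g x * Complex.I) - 1) ∂ν)) :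
    IsPoissonProcess ν (fun ξ => ξ) Q := by
  have hmc : ∀ A : Set ℝ, MeasurableSet A →
      Measurable fun ξ : LocFinMeasure => ξ.toMeasure A := fun A hA =>
    (Measure.measurable_coe hA).comp LocFinMeasure.measurable_toMeasure
  have hmr : ∀ A : Set ℝ, MeasurableSet A →
      Measurable fun ξ : LocFinMeasure => ξ.toMeasure.real A := fun A hA =>
    (hmc A hA).ennreal_toReal
  have hfin : ∀ (A : Set ℝ), Bornology.IsBounded A → ∀ ξ : LocFinMeasure, ξ.toMeasure A ≠ ∞ :=
    fun A hA ξ => hA.measure_lt_top.ne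
  -- joint characteristic functions of the counts of disjoint sets
  have hjoint : ∀ (n : ℕ) (A : Fin n → Set ℝ), (∀ j, MeasurableSet (A j)) →
      (∀ j, Bornology.IsBounded (A j)) → Pairwise (fun j k => Disjoint (A j) (A k)) →
      ∀ t : Fin n → ℝ,
      ∫ ξ, Complex.exp ((∑ j, t j * ξ.toMeasure.real (A j) : ℝ) * Complex.I) ∂Q
        = ∏ j, Complex.exp (ν.real (A j) * (Complex.exp (t j * Complex.I) - 1)) := by
    intro n A hA hAb hAd t
    let g : ℝ → ℝ := fun x => ∑ j, (A j).indicator (fun _ => t j) x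
    have hR : ∃ R : ℕ, ∀ j, ∀ x ∈ A j, |x| ≤ R := by
      choose r hr using fun j => (hAb j).subset_closedBall 0
      obtain ⟨R, hR⟩ := exists_nat_ge (∑ j, |r j|)
      refine ⟨R, fun j x hx => ?_⟩
      have h1 := hr j hx
      rw [mem_closedBall_zero_iff, Real.norm_eq_abs] at h1
      have h2 := Finset.single_le_sum (f := fun j => |r j|) (fun j _ => abs_nonneg _)
        (Finset.mem_univ j)
      linarith [le_abs_self (r j)]
    obtain ⟨R, hR⟩ := hR
    have hg : IsBoundedTest g := by
      refine ⟨Finset.measurable_fun_sum _ fun j _ => measurable_const.indicator (hA j),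
        ⟨∑ j, |t j|, fun x => ?_⟩, ⟨R, fun x hx => Finset.sum_eq_zero fun j _ => ?_⟩⟩
      · refine (Finset.abs_sum_le_sum_abs _ _).trans (Finset.sum_le_sum fun j _ => ?_)
        by_cases hx : x ∈ A j <;> simp [hx]
      · exact Set.indicator_of_notMem (fun hxj => hx.not_ge (hR j x hxj)) _
    have hi : ∀ (ξ : Measure ℝ) [IsLocallyFiniteMeasure ξ], ∀ j,
        Integrable ((A j).indicator fun _ => t j) ξ := fun ξ _ j =>
      (integrable_indicator_iff (hA j)).2 (integrableOn_const (hAb j).measure_lt_top.ne)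
    have e1 : ∀ ξ : LocFinMeasure, ∫ x, g x ∂ξ.toMeasure
        = ∑ j, t j * ξ.toMeasure.real (A j) := by
      intro ξ
      rw [integral_finsetSum _ fun j _ => hi _ j]
      refine Finset.sum_congr rfl fun j _ => ?_
      rw [integral_indicator_const _ (hA j), smul_eq_mul, mul_comm]
    have e2 : ∀ x, Complex.exp (g x * Complex.I) - 1
        = ∑ j, (A j).indicator (fun _ => Complex.exp (t j * Complex.I) - 1) x := by
      intro x
      by_cases hx : ∃ j, x ∈ A j
      · obtain ⟨j, hj⟩ := hx
        have hk : ∀ k, k ≠ j → x ∉ A k := fun k hkj hxk =>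
          Set.disjoint_left.1 (hAd hkj) hxk hj
        have : g x = t j := by
          simp only [g]
          rw [Finset.sum_eq_single j (fun k _ hkj => Set.indicator_of_notMem (hk k hkj) _)
            (by simp), Set.indicator_of_mem hj]
        rw [this, Finset.sum_eq_single j (fun k _ hkj => Set.indicator_of_notMem (hk k hkj) _)
            (by simp), Set.indicator_of_mem hj]
      · push Not at hx
        simp [g, hx]
    have := h g hg
    simp_rw [e1] at this
    rw [this, ← Complex.exp_sum]
    simp_rw [e2]
    rw [integral_finsetSum _ fun j _ =>
      (integrable_indicator_iff (hA j)).2 (integrableOn_const (hAb j).measure_lt_top.ne)]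
    congr 1
    refine Finset.sum_congr rfl fun j _ => ?_
    rw [integral_indicator_const _ (hA j), Complex.real_smul]
  have hone : ∀ A : Set ℝ, MeasurableSet A → Bornology.IsBounded A → ∀ t : ℝ,
      charFun (Q.map fun ξ => ξ.toMeasure.real A) t
        = Complex.exp (ν.real A * (Complex.exp (t * Complex.I) - 1)) := by
    intro A hA hAb t
    rw [charFun_apply_real, integral_map (hmr A hA).aemeasurable
      (Measurable.aestronglyMeasurable (by fun_prop))]
    have := hjoint 1 (fun _ => A) (fun _ => hA) (fun _ => hAb)
      (fun j k hjk => (hjk (Subsingleton.elim _ _)).elim) fun _ => t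
    simpa using this
  refine ⟨aemeasurable_id, fun A hA hAb => ⟨(hmc A hA).aemeasurable, ?_⟩, ?_⟩
  · have hprob : IsProbabilityMeasure (Q.map fun ξ => ξ.toMeasure.real A) :=
      Measure.isProbabilityMeasure_map (hmr A hA).aemeasurable
    have e1 : (Q.map fun ξ => ξ.toMeasure.real A)
        = (poissonMeasure (ν A).toNNReal).map (fun n : ℕ => (n : ℝ)) := by
      refine Measure.ext_of_charFun (funext fun t => ?_)
      rw [hone A hA hAb, charFun_map_cast_poissonMeasure]
      rfl
    have e2 : (fun ξ : LocFinMeasure => ξ.toMeasure A)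
        = ENNReal.ofReal ∘ fun ξ : LocFinMeasure => ξ.toMeasure.real A := by
      funext ξ
      exact (ofReal_measureReal (hfin A hAb ξ)).symm
    rw [e2, ← Measure.map_map ENNReal.measurable_ofReal (hmr A hA), e1,
      Measure.map_map ENNReal.measurable_ofReal (measurable_of_countable _)]
    congr 1
    funext n
    simp
  · intro n A hA hAb hAd
    have hind : iIndepFun (fun j (ξ : LocFinMeasure) => ξ.toMeasure.real (A j)) Q := by
      rw [iIndepFun_iff_charFun_pi fun j => (hmr _ (hA j)).aemeasurable]
      intro t
      have hmr' := fun j => hmr _ (hA j)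
      rw [charFun_apply, integral_map (Measurable.aemeasurable (by fun_prop))
        (Measurable.aestronglyMeasurable (by fun_prop))]
      simp_rw [hone _ (hA _) (hAb _)]
      rw [← hjoint n A hA hAb hAd]
      simp [PiLp.inner_apply]
    have := hind.comp (fun _ => ENNReal.ofReal) fun _ => ENNReal.measurable_ofReal
    convert this using 2 with j
    funext ξ
    exact (ofReal_measureReal (hfin _ (hAb j) ξ)).symm

theorem isPoissonProcess_poissonLaw (ν : Measure ℝ) [IsLocallyFiniteMeasure ν] :
    IsPoissonProcess ν (fun ξ => ξ) (poissonLaw ν) :=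
  isPoissonProcess_of_charFunctional ν _ fun _ hg => charFunctional_poissonLaw ν hg

/-! ### Products of complex numbers close to one -/

theorem norm_prod_sub_prod_le {ι : Type*} (s : Finset ι) {x y : ι → ℂ} (hx : ∀ i, ‖x i‖ ≤ 1)
    (hy : ∀ i, ‖y i‖ ≤ 1) : ‖∏ i ∈ s, x i - ∏ i ∈ s, y i‖ ≤ ∑ i ∈ s, ‖x i - y i‖ := by
  classical
  induction s using Finset.induction_on with
  | empty => simp
  | insert i s hi ih =>
    rw [Finset.prod_insert hi, Finset.prod_insert hi, Finset.sum_insert hi]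
    have h1 : ‖∏ j ∈ s, x j‖ ≤ 1 := by
      rw [norm_prod]
      exact Finset.prod_le_one (fun j _ => norm_nonneg _) fun j _ => hx j
    calc ‖x i * ∏ j ∈ s, x j - y i * ∏ j ∈ s, y j‖
        = ‖(x i - y i) * ∏ j ∈ s, x j + y i * (∏ j ∈ s, x j - ∏ j ∈ s, y j)‖ := by ring_nf
      _ ≤ ‖x i - y i‖ * 1 + 1 * ∑ j ∈ s, ‖x j - y j‖ := by
          refine (norm_add_le _ _).trans ?_
          rw [norm_mul, norm_mul]
          gcongr
          exact hy i
      _ = _ := by ring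

/-- The Poisson limit theorem for triangular arrays, in the form of a statement on products. -/
theorem tendsto_prod_one_add {ι : ℕ → Type*} [∀ n, Fintype (ι n)] {a : ∀ n, ι n → ℂ} {l : ℂ}
    {K : ℝ} {ε : ℕ → ℝ} (h1 : ∀ n i, ‖1 + a n i‖ ≤ 1) (hε : ∀ᶠ n in atTop, ∀ i, ‖a n i‖ ≤ ε n)
    (hε0 : Tendsto ε atTop (𝓝 0)) (hK : ∀ᶠ n in atTop, ∑ i, ‖a n i‖ ≤ K)
    (hl : Tendsto (fun n => ∑ i, a n i) atTop (𝓝 l)) :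
    Tendsto (fun n => ∏ i, (1 + a n i)) atTop (𝓝 (Complex.exp l)) := by
  have hre : ∀ n i, ‖Complex.exp (a n i)‖ ≤ 1 := by
    intro n i
    rw [Complex.norm_exp, Real.exp_le_one_iff]
    have := (Complex.re_le_norm _).trans (h1 n i)
    simp only [Complex.add_re, Complex.one_re] at this
    linarith
  have h2 : Tendsto (fun n => ∏ i, (1 + a n i) - Complex.exp (∑ i, a n i)) atTop (𝓝 0) := by
    have h3 : Tendsto (fun n => |ε n| * K) atTop (𝓝 0) := by simpa using hε0.abs.mul_const K
    refine squeeze_zero_norm' ?_ h3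
    filter_upwards [hε, hK, hε0.eventually_le_const zero_lt_one] with n hn hKn hn1
    rw [Complex.exp_sum]
    refine (norm_prod_sub_prod_le _ (h1 n) (hre n)).trans ?_
    calc ∑ i, ‖1 + a n i - Complex.exp (a n i)‖ ≤ ∑ i, |ε n| * ‖a n i‖ := by
          refine Finset.sum_le_sum fun i _ => ?_
          have := Complex.norm_exp_sub_one_sub_id_le ((hn i).trans hn1)
          rw [← norm_neg]
          calc ‖-(1 + a n i - Complex.exp (a n i))‖ = ‖Complex.exp (a n i) - 1 - a n i‖ := by
                ring_nf
            _ ≤ ‖a n i‖ ^ 2 := this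
            _ ≤ |ε n| * ‖a n i‖ := by
                rw [sq]
                gcongr
                exact (hn i).trans (le_abs_self _)
      _ = |ε n| * ∑ i, ‖a n i‖ := (Finset.mul_sum _ _ _).symm
      _ ≤ |ε n| * K := by gcongr
  have h4 := h2.add ((Complex.continuous_exp.tendsto l).comp hl)
  simpa using h4

/-! ### Hyperbolic functions -/

theorem hasDerivAt_tanh (x : ℝ) : HasDerivAt Real.tanh (1 / Real.cosh x ^ 2) x := by
  have h : HasDerivAt (fun x => Real.sinh x / Real.cosh x)
      ((Real.cosh x * Real.cosh x - Real.sinh x * Real.sinh x) / Real.cosh x ^ 2) x :=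
    (Real.hasDerivAt_sinh x).div (Real.hasDerivAt_cosh x) (Real.cosh_pos x).ne'
  have e : (fun x => Real.sinh x / Real.cosh x) = Real.tanh := by
    funext x
    rw [Real.tanh_eq_sinh_div_cosh]
  rw [e] at h
  convert h using 2
  nlinarith [Real.cosh_sq x]

theorem continuous_tanh : Continuous Real.tanh :=
  continuous_iff_continuousAt.2 fun x => (hasDerivAt_tanh x).continuousAt

theorem abs_tanh_le_one (x : ℝ) : |Real.tanh x| ≤ 1 := (Real.abs_tanh_lt_one x).le

theorem one_sub_tanh_sq (x : ℝ) : 1 - Real.tanh x ^ 2 = 1 / Real.cosh x ^ 2 := by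
  have h := Real.cosh_pos x
  rw [Real.tanh_eq_sinh_div_cosh]
  field_simp
  nlinarith [Real.cosh_sq x]

theorem abs_tanh_sub_tanh_le (x y : ℝ) : |Real.tanh x - Real.tanh y| ≤ |x - y| := by
  have := Convex.norm_image_sub_le_of_norm_hasDerivWithin_le (f := Real.tanh)
    (f' := fun x => 1 / Real.cosh x ^ 2) (C := 1) (s := Set.univ) (x := y) (y := x)
    (fun x _ => (hasDerivAt_tanh x).hasDerivWithinAt) (fun x _ => ?_) convex_univ trivial trivial
  · simpa using this
  · rw [Real.norm_of_nonneg (by positivity), div_le_one (by have := Real.cosh_pos x; positivity)]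
    nlinarith [Real.one_le_cosh x]

theorem abs_inv_cosh_sq_sub_le (x y : ℝ) :
    |1 / Real.cosh x ^ 2 - 1 / Real.cosh y ^ 2| ≤ 2 * |x - y| := by
  rw [← one_sub_tanh_sq, ← one_sub_tanh_sq]
  have e : 1 - Real.tanh x ^ 2 - (1 - Real.tanh y ^ 2)
      = -((Real.tanh x + Real.tanh y) * (Real.tanh x - Real.tanh y)) := by ring
  rw [e, abs_neg, abs_mul]
  have h1 : |Real.tanh x + Real.tanh y| ≤ 2 := by
    linarith [abs_add_le (Real.tanh x) (Real.tanh y), abs_tanh_le_one x, abs_tanh_le_one y]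
  exact mul_le_mul h1 (abs_tanh_sub_tanh_le x y) (abs_nonneg _) zero_le_two

/-! ### The tilted spin -/

/-- The characteristic function at `t` of `x (σ - tanh (β x))`, where the spin `σ = ±1` has
probabilities proportional to `e^{β x σ}`. -/
def tiltChar (β x t : ℝ) : ℂ :=
  (Real.exp (β * x) / (2 * Real.cosh (β * x)) : ℝ) *
      Complex.exp ((t * x * (1 - Real.tanh (β * x)) : ℝ) * Complex.I) +
    (Real.exp (-(β * x)) / (2 * Real.cosh (β * x)) : ℝ) *
      Complex.exp ((t * x * (-1 - Real.tanh (β * x)) : ℝ) * Complex.I)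

theorem tilt_add (y : ℝ) :
    Real.exp y / (2 * Real.cosh y) + Real.exp (-y) / (2 * Real.cosh y) = 1 := by
  have h := Real.cosh_pos y
  rw [← add_div, div_eq_one_iff_eq (by positivity), Real.cosh_eq]
  ring

theorem tilt_sub (y : ℝ) :
    Real.exp y / (2 * Real.cosh y) - Real.exp (-y) / (2 * Real.cosh y) = Real.tanh y := by
  have h := Real.cosh_pos y
  rw [← sub_div, Real.tanh_eq_sinh_div_cosh, Real.sinh_eq]
  field_simp

theorem norm_tiltChar_le_one (β x t : ℝ) : ‖tiltChar β x t‖ ≤ 1 := by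
  have h := Real.cosh_pos (β * x)
  rw [← tilt_add (β * x)]
  refine (norm_add_le _ _).trans (le_of_eq ?_)
  rw [norm_mul, norm_mul, Complex.norm_exp_ofReal_mul_I, Complex.norm_exp_ofReal_mul_I,
    Complex.norm_real, Complex.norm_real, Real.norm_of_nonneg (by positivity),
    Real.norm_of_nonneg (by positivity), mul_one, mul_one]

theorem continuous_tiltChar (β x : ℝ) : Continuous (tiltChar β x) := by
  unfold tiltChar
  fun_prop

theorem norm_cexp_sub_taylor_le (θ : ℝ) :
    ‖Complex.exp (θ * Complex.I) - (1 + θ * Complex.I - θ ^ 2 / 2)‖ ≤ 4 * |θ| ^ 3 := by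
  have hn : ‖(θ * Complex.I : ℂ)‖ = |θ| := by simp
  rcases le_total |θ| 1 with h | h
  · have := Complex.exp_bound (x := θ * Complex.I) (by rwa [hn]) (n := 3) (by norm_num)
    rw [hn] at this
    have e : ∑ m ∈ Finset.range 3, (θ * Complex.I : ℂ) ^ m / m.factorial
        = 1 + θ * Complex.I - θ ^ 2 / 2 := by
      simp only [Finset.sum_range_succ, Finset.range_zero, Finset.sum_empty]
      norm_num [Nat.factorial, mul_pow]
      ring
    rw [e] at this
    refine this.trans ?_
    rw [mul_comm]
    gcongr
    norm_num [Nat.factorial]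
  · have h2 : (1 : ℝ) ≤ |θ| ^ 2 := one_le_pow₀ h
    calc ‖Complex.exp (θ * Complex.I) - (1 + θ * Complex.I - θ ^ 2 / 2)‖
        ≤ 1 + (1 + |θ| + |θ| ^ 2 / 2) := by
          refine (norm_sub_le _ _).trans ?_
          rw [Complex.norm_exp_ofReal_mul_I]
          gcongr
          refine (norm_sub_le _ _).trans ?_
          gcongr
          · refine (norm_add_le _ _).trans ?_
            simp
          · simp
      _ ≤ 4 * |θ| ^ 3 := by nlinarith

theorem norm_tiltChar_sub_le (β x t : ℝ) :
    ‖tiltChar β x t - (1 - t ^ 2 * (x ^ 2 / Real.cosh (β * x) ^ 2) / 2 : ℝ)‖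
      ≤ 32 * |t * x| ^ 3 := by
  have hc := Real.cosh_pos (β * x)
  set p := Real.exp (β * x) / (2 * Real.cosh (β * x)) with hp
  set q := Real.exp (-(β * x)) / (2 * Real.cosh (β * x)) with hq
  set T := Real.tanh (β * x) with hT
  have hp0 : 0 ≤ p := by positivity
  have hq0 : 0 ≤ q := by positivity
  have hpq : p + q = 1 := tilt_add _
  have hpT : p - q = T := tilt_sub _
  have hw : x ^ 2 / Real.cosh (β * x) ^ 2 = x ^ 2 * (1 - T ^ 2) := by
    rw [one_sub_tanh_sq]
    ring
  obtain ⟨hT1, hT2⟩ := abs_le.1 (abs_tanh_le_one (β * x))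
  -- the tilted spin has mean `T` and variance `1 - T²`
  have e : tiltChar β x t - (1 - t ^ 2 * (x ^ 2 / Real.cosh (β * x) ^ 2) / 2 : ℝ)
      = p * (Complex.exp ((t * x * (1 - T) : ℝ) * Complex.I)
          - (1 + (t * x * (1 - T) : ℝ) * Complex.I - ((t * x * (1 - T) : ℝ) : ℂ) ^ 2 / 2))
        + q * (Complex.exp ((t * x * (-1 - T) : ℝ) * Complex.I)
          - (1 + (t * x * (-1 - T) : ℝ) * Complex.I
            - ((t * x * (-1 - T) : ℝ) : ℂ) ^ 2 / 2)) := by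
    rw [hw, tiltChar]
    have h1 : (q : ℂ) = 1 - p := by rw [← Complex.ofReal_one, ← hpq]; push_cast; ring
    have h2 : (T : ℂ) = 2 * p - 1 := by
      rw [← hpT, Complex.ofReal_sub, h1]
      ring
    rw [← hp, ← hq, ← hT]
    push_cast
    rw [h1, h2]
    ring
  have hb : ∀ s : ℝ, |s| ≤ 2 → 4 * |t * x * s| ^ 3 ≤ 32 * |t * x| ^ 3 := by
    intro s hs
    rw [abs_mul, mul_pow]
    have : |s| ^ 3 ≤ 2 ^ 3 := by gcongr
    nlinarith [pow_nonneg (abs_nonneg (t * x)) 3]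
  rw [e]
  refine (norm_add_le _ _).trans ?_
  rw [norm_mul, norm_mul, Complex.norm_real, Complex.norm_real, Real.norm_of_nonneg hp0,
    Real.norm_of_nonneg hq0]
  have h1 := (norm_cexp_sub_taylor_le (t * x * (1 - T))).trans
    (hb (1 - T) (abs_le.2 ⟨by linarith, by linarith⟩))
  have h2 := (norm_cexp_sub_taylor_le (t * x * (-1 - T))).trans
    (hb (-1 - T) (abs_le.2 ⟨by linarith, by linarith⟩))
  calc _ ≤ p * (32 * |t * x| ^ 3) + q * (32 * |t * x| ^ 3) := by gcongr
    _ = 32 * |t * x| ^ 3 := by rw [← add_mul, hpq, one_mul]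

theorem abs_exp_neg_sub_le {u : ℝ} (hu : 0 ≤ u) : |Real.exp (-u) - (1 - u)| ≤ u ^ 2 := by
  have h1 := Real.add_one_le_exp (-u)
  rw [abs_of_nonneg (by linarith)]
  have h2 : Real.exp (-u) ≤ 1 / (1 + u) := by
    rw [Real.exp_neg, one_div]
    gcongr
    linarith [Real.add_one_le_exp u]
  have h3 : 1 / (1 + u) ≤ 1 - u + u ^ 2 := by
    rw [div_le_iff₀ (by positivity)]
    nlinarith [pow_nonneg hu 3]
  linarith

/-- Quantitative Gaussian approximation for the sum of the centered tilted spins. -/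
theorem norm_prod_tiltChar_sub_le {ι : Type*} [Fintype ι] (β t : ℝ) (x : ι → ℝ) :
    ‖∏ i, tiltChar β (x i) t
        - (Real.exp (-(t ^ 2 / 2 * ∑ i, x i ^ 2 / Real.cosh (β * x i) ^ 2)) : ℝ)‖
      ≤ (32 * |t| ^ 3 + t ^ 4) * ∑ i, (1 + x i ^ 4) := by
  have e : ((Real.exp (-(t ^ 2 / 2 * ∑ i, x i ^ 2 / Real.cosh (β * x i) ^ 2)) : ℝ) : ℂ)
      = ∏ i, ((Real.exp (-(t ^ 2 * (x i ^ 2 / Real.cosh (β * x i) ^ 2) / 2)) : ℝ) : ℂ) := by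
    rw [← Complex.ofReal_prod, ← Real.exp_sum, Finset.mul_sum, ← Finset.sum_neg_distrib]
    congr 3
    funext i
    ring
  rw [e, Finset.mul_sum]
  refine (norm_prod_sub_prod_le _ (fun i => norm_tiltChar_le_one _ _ _) fun i => ?_).trans
    (Finset.sum_le_sum fun i _ => ?_)
  · rw [Complex.norm_real, Real.norm_of_nonneg (Real.exp_pos _).le, Real.exp_le_one_iff]
    have := Real.cosh_pos (β * x i)
    have : 0 ≤ t ^ 2 * (x i ^ 2 / Real.cosh (β * x i) ^ 2) / 2 := by positivity
    linarith
  · have hc : (1 : ℝ) ≤ Real.cosh (β * x i) ^ 2 := one_le_pow₀ (Real.one_le_cosh _)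
    set w := x i ^ 2 / Real.cosh (β * x i) ^ 2 with hw
    have hw0 : 0 ≤ w := by positivity
    have hwx : w ≤ x i ^ 2 := div_le_self (sq_nonneg _) hc
    have h1 := norm_tiltChar_sub_le β (x i) t
    have h2 := abs_exp_neg_sub_le (u := t ^ 2 * w / 2) (by positivity)
    have h3 : ‖tiltChar β (x i) t - (Real.exp (-(t ^ 2 * w / 2)) : ℝ)‖
        ≤ 32 * |t * x i| ^ 3 + (t ^ 2 * w / 2) ^ 2 := by
      calc _ = ‖(tiltChar β (x i) t - (1 - t ^ 2 * w / 2 : ℝ))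
            - ((Real.exp (-(t ^ 2 * w / 2)) - (1 - t ^ 2 * w / 2) : ℝ) : ℂ)‖ := by
            congr 1
            push_cast
            ring
        _ ≤ _ := by
            refine (norm_sub_le _ _).trans (add_le_add h1 ?_)
            rwa [Complex.norm_real]
    refine h3.trans ?_
    have h4 : |x i| ^ 3 ≤ 1 + x i ^ 4 := by
      have e4 : x i ^ 4 = |x i| ^ 4 := (Even.pow_abs (by decide) _).symm
      rw [e4]
      have h0 := abs_nonneg (x i)
      rcases le_total |x i| 1 with h | h
      · have : |x i| ^ 3 ≤ 1 := pow_le_one₀ h0 h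
        have : 0 ≤ |x i| ^ 4 := by positivity
        linarith
      · have : |x i| ^ 3 ≤ |x i| ^ 4 := pow_le_pow_right₀ h (by norm_num)
        linarith
    have h5 : (t ^ 2 * w / 2) ^ 2 ≤ t ^ 4 * (1 + x i ^ 4) := by
      have : w ^ 2 ≤ x i ^ 4 := by
        calc w ^ 2 ≤ (x i ^ 2) ^ 2 := by gcongr
          _ = x i ^ 4 := by ring
      calc (t ^ 2 * w / 2) ^ 2 = t ^ 4 * (w ^ 2 / 4) := by ring
        _ ≤ t ^ 4 * (1 + x i ^ 4) := by
            gcongr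
            linarith [sq_nonneg w]
    have h6 : 32 * |t * x i| ^ 3 ≤ 32 * |t| ^ 3 * (1 + x i ^ 4) := by
      rw [abs_mul, mul_pow, mul_assoc]
      gcongr
    linarith

/-! ### The mean density of energy levels -/

/-- The energy `∑ᵢ fᵢ σᵢ` of a configuration in the magnetic field `f`. -/
def spinSum (f : ℕ → ℝ) (N : ℕ) (σ : Config N) : ℝ := ∑ i : Fin N, f i * ((σ i : ℤ) : ℝ)

/-- The density of the intensity measure of the energy levels in the field `f`. -/
def levelDensity (f : ℕ → ℝ) (N : ℕ) (y : ℝ) : ℝ :=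
  ∑ σ : Config N, gaussianPDFReal (spinSum f N σ) N y

/-- `u tanh u - log cosh u`, the entropy that a spin loses, relative to `log 2`, when it is tilted
by `e^{u σ}`. -/
def entropyLoss (u : ℝ) : ℝ := u * Real.tanh u - Real.log (Real.cosh u)

/-- The mean energy of the model tilted at inverse temperature `b`, with a logarithmic correction.
-/
def tiltedLevel (f : ℕ → ℝ) (N : ℕ) (b : ℝ) : ℝ :=
  N * b + ∑ i : Fin N, f i * Real.tanh (b * f i) - Real.log N / (2 * b)

theorem gaussianPDFReal_eq_tilt (m b y : ℝ) {N : ℕ} (hN : N ≠ 0) :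
    gaussianPDFReal m N y
      = Real.exp (-(b * y) + N * b ^ 2 / 2) * Real.exp (b * m)
        * gaussianPDFReal (m + N * b) N y := by
  have hN' : (N : ℝ) ≠ 0 := by exact_mod_cast hN
  simp only [gaussianPDFReal, NNReal.coe_natCast]
  rw [mul_left_comm, ← Real.exp_add, ← Real.exp_add]
  congr 2
  field_simp
  ring

/-- The Gaussian density as the Fourier transform of a Gaussian. -/
theorem gaussianPDFReal_eq_integral (m y : ℝ) {N : ℕ} (hN : N ≠ 0) :
    (gaussianPDFReal m N y : ℂ) = (1 / (2 * Real.pi * √N) : ℝ) *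
      ∫ s : ℝ, Complex.exp ((-(s * ((y - m) / √N)) : ℝ) * Complex.I) *
        (Real.exp (-(s ^ 2 / 2)) : ℝ) := by
  have hN' : (0 : ℝ) < N := by exact_mod_cast Nat.pos_of_ne_zero hN
  have h := fourierIntegral_gaussian (b := 1 / 2) (by norm_num) (-((y - m) / √N : ℝ) : ℂ)
  have e : ∀ s : ℝ, Complex.exp ((-(s * ((y - m) / √N)) : ℝ) * Complex.I) *
        (Real.exp (-(s ^ 2 / 2)) : ℝ)
      = Complex.exp (Complex.I * (-((y - m) / √N : ℝ) : ℂ) * s)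
        * Complex.exp (-(1 / 2) * (s : ℂ) ^ 2) := by
    intro s
    push_cast
    congr 2 <;> ring
  simp_rw [e]
  rw [h]
  have e2 : ((Real.pi : ℂ) / (1 / 2)) ^ (1 / 2 : ℂ) = (√(2 * Real.pi) : ℝ) := by
    rw [Real.sqrt_eq_rpow, Complex.ofReal_cpow (by positivity)]
    congr 1 <;> push_cast <;> ring
  have e3 : Complex.exp (-(-((y - m) / √N : ℝ) : ℂ) ^ 2 / (4 * (1 / 2)))
      = (Real.exp (-(y - m) ^ 2 / (2 * N)) : ℝ) := by
    rw [Complex.ofReal_exp]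
    congr 1
    have : ((√N : ℝ) : ℂ) ^ 2 = N := by
      rw [← Complex.ofReal_pow, Real.sq_sqrt hN'.le]
      simp
    have hNc : (N : ℂ) ≠ 0 := by exact_mod_cast hN
    push_cast
    rw [neg_sq, div_pow, this]
    field_simp
    ring
  rw [e2, e3]
  simp only [gaussianPDFReal, NNReal.coe_natCast]
  rw [← Complex.ofReal_mul, ← Complex.ofReal_mul]
  congr 1
  rw [← mul_assoc]
  congr 1
  rw [Real.sqrt_mul (by positivity)]
  have h1 : √(2 * Real.pi) * √(2 * Real.pi) = 2 * Real.pi := Real.mul_self_sqrt (by positivity)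
  have h2 : 0 < √(2 * Real.pi) := by positivity
  have h3 : 0 < √(N : ℝ) := by positivity
  field_simp
  nlinarith

/-- Summing over configurations factorizes into single spins. -/
theorem sum_config_eq_prod (f : ℕ → ℝ) (N : ℕ) (b t : ℝ) :
    ∑ σ : Config N, (Real.exp (b * spinSum f N σ) : ℂ) *
        Complex.exp ((t * (spinSum f N σ - ∑ i : Fin N, f i * Real.tanh (b * f i)) : ℝ)
          * Complex.I)
      = ∏ i : Fin N, (2 * Real.cosh (b * f i) : ℝ) * tiltChar b (f i) t := by
  have e1 : ∀ i : Fin N, ((2 * Real.cosh (b * f i) : ℝ) : ℂ) * tiltChar b (f i) t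
      = ∑ u : ℤˣ, (Real.exp (b * (f i * ((u : ℤ) : ℝ))) : ℂ) *
        Complex.exp ((t * (f i * ((u : ℤ) : ℝ) - f i * Real.tanh (b * f i)) : ℝ)
          * Complex.I) := by
    intro i
    have hc : ((2 * Real.cosh (b * f i) : ℝ) : ℂ) ≠ 0 := by
      have := Real.cosh_pos (b * f i)
      exact_mod_cast (by positivity : 2 * Real.cosh (b * f i) ≠ 0)
    rw [UnitsInt.univ, Finset.sum_pair (by decide), tiltChar, mul_add, ← mul_assoc, ← mul_assoc,
      Complex.ofReal_div, Complex.ofReal_div, mul_div_cancel₀ _ hc, mul_div_cancel₀ _ hc]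
    congr 2
    · congr 2
      simp
    · congr 3
      push_cast
      ring
    · congr 2
      simp
    · congr 3
      push_cast
      ring
  simp_rw [e1]
  rw [Finset.prod_univ_sum, Fintype.piFinset_univ]
  refine Finset.sum_congr rfl fun σ _ => ?_
  rw [Finset.prod_mul_distrib, ← Complex.exp_sum, ← Complex.ofReal_prod, ← Real.exp_sum,
    ← Finset.sum_mul, ← Complex.ofReal_sum, ← Finset.mul_sum, ← Finset.mul_sum,
    Finset.sum_sub_distrib]
  rfl

theorem integrable_exp_neg_sq_half : Integrable fun s : ℝ => Real.exp (-(s ^ 2 / 2)) := by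
  have := integrable_exp_neg_mul_sq (b := 1 / 2) (by norm_num)
  refine this.congr (ae_of_all _ fun s => ?_)
  simp only
  congr 1
  ring

/-- Tilting the level density by `e^{b y}` and Fourier inversion. -/
theorem levelDensity_eq_integral (f : ℕ → ℝ) {N : ℕ} (hN : N ≠ 0) (b y : ℝ) :
    (levelDensity f N y : ℂ)
      = (Real.exp (-(b * y) + N * b ^ 2 / 2) * (∏ i : Fin N, 2 * Real.cosh (b * f i))
          / (2 * Real.pi * √N) : ℝ) *
        ∫ s : ℝ, Complex.exp ((-(s * ((y - N * b - ∑ i : Fin N, f i * Real.tanh (b * f i)) / √N))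
            : ℝ) * Complex.I) * (Real.exp (-(s ^ 2 / 2)) : ℝ) *
          ∏ i : Fin N, tiltChar b (f i) (s / √N) := by
  have hN' : (0 : ℝ) < N := by exact_mod_cast Nat.pos_of_ne_zero hN
  set A := ∑ i : Fin N, f i * Real.tanh (b * f i) with hA
  have hi : ∀ σ : Config N, Integrable fun s : ℝ => (Real.exp (b * spinSum f N σ) : ℂ) *
      (Complex.exp ((-(s * ((y - (spinSum f N σ + N * b)) / √N)) : ℝ) * Complex.I) *
        (Real.exp (-(s ^ 2 / 2)) : ℝ)) := by
    intro σ
    refine Integrable.const_mul (integrable_exp_neg_sq_half.ofReal.bdd_mul (c := 1)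
      (Measurable.aestronglyMeasurable (by fun_prop)) (ae_of_all _ fun s => ?_)) _
    rw [Complex.norm_exp_ofReal_mul_I]
  have e1 : ∀ s : ℝ, ∑ σ : Config N, (Real.exp (b * spinSum f N σ) : ℂ) *
      (Complex.exp ((-(s * ((y - (spinSum f N σ + N * b)) / √N)) : ℝ) * Complex.I) *
        (Real.exp (-(s ^ 2 / 2)) : ℝ))
      = (∏ i : Fin N, 2 * Real.cosh (b * f i) : ℝ) *
        (Complex.exp ((-(s * ((y - N * b - A) / √N)) : ℝ) * Complex.I) *
          (Real.exp (-(s ^ 2 / 2)) : ℝ) * ∏ i : Fin N, tiltChar b (f i) (s / √N)) := by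
    intro s
    have h := sum_config_eq_prod f N b (s / √N)
    rw [Finset.prod_mul_distrib, ← Complex.ofReal_prod, ← hA] at h
    rw [mul_left_comm, ← h, Finset.mul_sum]
    refine Finset.sum_congr rfl fun σ _ => ?_
    rw [mul_left_comm _ (Real.exp (b * spinSum f N σ) : ℂ), mul_right_comm, ← Complex.exp_add]
    congr 3
    rw [← add_mul, ← Complex.ofReal_add]
    congr 2
    ring
  calc (levelDensity f N y : ℂ)
      = ∑ σ : Config N, (Real.exp (-(b * y) + N * b ^ 2 / 2) / (2 * Real.pi * √N) : ℝ) *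
          ∫ s : ℝ, (Real.exp (b * spinSum f N σ) : ℂ) *
            (Complex.exp ((-(s * ((y - (spinSum f N σ + N * b)) / √N)) : ℝ) * Complex.I) *
              (Real.exp (-(s ^ 2 / 2)) : ℝ)) := by
        rw [levelDensity, Complex.ofReal_sum]
        refine Finset.sum_congr rfl fun σ _ => ?_
        rw [gaussianPDFReal_eq_tilt _ b y hN, Complex.ofReal_mul,
          gaussianPDFReal_eq_integral _ _ hN, integral_const_mul]
        push_cast
        ring
    _ = _ := by
        rw [← Finset.mul_sum, ← integral_finsetSum _ fun σ _ => hi σ]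
        simp_rw [e1]
        rw [integral_const_mul, ← mul_assoc, ← Complex.ofReal_mul]
        congr 2
        ring

/-- When the entropy lost by the spins and by the Gaussian energies adds up to `N log 2`, the
exponential prefactor at `tiltedLevel` cancels up to the local profile `e^{-b z}`. -/
theorem levelDensity_tiltedLevel (f : ℕ → ℝ) {N : ℕ} (hN : N ≠ 0) {b : ℝ} (hb : b ≠ 0)
    (hbal : ∑ i : Fin N, entropyLoss (b * f i) + N * (b ^ 2 / 2) = N * Real.log 2) (z : ℝ) :
    (levelDensity f N (z + tiltedLevel f N b) : ℂ) = (Real.exp (-(b * z)) / (2 * Real.pi) : ℝ) *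
      ∫ s : ℝ, Complex.exp ((-(s * ((z - Real.log N / (2 * b)) / √N)) : ℝ) * Complex.I) *
        (Real.exp (-(s ^ 2 / 2)) : ℝ) * ∏ i : Fin N, tiltChar b (f i) (s / √N) := by
  have hN' : (0 : ℝ) < N := by exact_mod_cast Nat.pos_of_ne_zero hN
  rw [levelDensity_eq_integral f hN b]
  set A := ∑ i : Fin N, f i * Real.tanh (b * f i) with hA
  have e1 : z + tiltedLevel f N b - N * b - A = z - Real.log N / (2 * b) := by
    rw [tiltedLevel, ← hA]
    ring
  rw [e1]
  congr 2
  have e2 : ∏ i : Fin N, 2 * Real.cosh (b * f i)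
      = Real.exp (N * Real.log 2 + ∑ i : Fin N, Real.log (Real.cosh (b * f i))) := by
    rw [Finset.prod_mul_distrib, Real.exp_add, Real.exp_sum, Finset.prod_const, Finset.card_univ,
      Fintype.card_fin, Real.exp_nat_mul, Real.exp_log two_pos]
    congr 1
    exact Finset.prod_congr rfl fun i _ => (Real.exp_log (Real.cosh_pos _)).symm
  have e3 : √(N : ℝ) = Real.exp (Real.log N / 2) := by
    rw [Real.sqrt_eq_rpow, Real.rpow_def_of_pos hN']
    congr 1
    ring
  have e4 : ∑ i : Fin N, entropyLoss (b * f i)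
      = b * A - ∑ i : Fin N, Real.log (Real.cosh (b * f i)) := by
    rw [hA, Finset.mul_sum, ← Finset.sum_sub_distrib]
    refine Finset.sum_congr rfl fun i _ => ?_
    rw [entropyLoss]
    ring
  rw [e4] at hbal
  have e5 : -(b * (z + tiltedLevel f N b)) + N * b ^ 2 / 2
      + (N * Real.log 2 + ∑ i : Fin N, Real.log (Real.cosh (b * f i)))
      = -(b * z) + Real.log N / 2 := by
    rw [← hbal, tiltedLevel, ← hA]
    field_simp
    ring
  rw [e2, ← Real.exp_add, e5, Real.exp_add, ← e3]
  have : 0 < √(N : ℝ) := by positivity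
  field_simp

theorem levelDensity_nonneg (f : ℕ → ℝ) (N : ℕ) (y : ℝ) : 0 ≤ levelDensity f N y :=
  Finset.sum_nonneg fun _ _ => gaussianPDFReal_nonneg _ _ _

theorem norm_prod_tiltChar_le_one (f : ℕ → ℝ) (N : ℕ) (b t : ℝ) :
    ‖∏ i : Fin N, tiltChar b (f i) t‖ ≤ 1 := by
  rw [norm_prod]
  exact Finset.prod_le_one (fun _ _ => norm_nonneg _) fun _ _ => norm_tiltChar_le_one _ _ _

theorem integral_exp_neg_sq_half_mul {c : ℝ} :
    ∫ s : ℝ, Real.exp (-(s ^ 2 / 2)) * Real.exp (-(s ^ 2 / 2 * c))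
      = √(2 * Real.pi / (1 + c)) := by
  have := integral_gaussian ((1 + c) / 2)
  rw [show Real.pi / ((1 + c) / 2) = 2 * Real.pi / (1 + c) by
    rw [div_div_eq_mul_div, mul_comm]] at this
  rw [← this]
  refine integral_congr_ae (ae_of_all _ fun s => ?_)
  simp only
  rw [← Real.exp_add]
  congr 1
  ring

/-- The characteristic functions of the tilted spins are bounded by `1`, which leaves a Gaussian
integral. -/
theorem levelDensity_tiltedLevel_le (f : ℕ → ℝ) {N : ℕ} (hN : N ≠ 0) {b : ℝ} (hb : b ≠ 0)
    (hbal : ∑ i : Fin N, entropyLoss (b * f i) + N * (b ^ 2 / 2) = N * Real.log 2) (z : ℝ) :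
    levelDensity f N (z + tiltedLevel f N b) ≤ Real.exp (-(b * z)) := by
  have h := congrArg norm (levelDensity_tiltedLevel f hN hb hbal z)
  rw [Complex.norm_real, Real.norm_of_nonneg (levelDensity_nonneg _ _ _), norm_mul,
    Complex.norm_real, Real.norm_of_nonneg (by positivity)] at h
  rw [h]
  have h1 : ‖∫ s : ℝ, Complex.exp ((-(s * ((z - Real.log N / (2 * b)) / √N)) : ℝ) * Complex.I) *
        (Real.exp (-(s ^ 2 / 2)) : ℝ) * ∏ i : Fin N, tiltChar b (f i) (s / √N)‖
      ≤ ∫ s : ℝ, Real.exp (-(s ^ 2 / 2)) := by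
    refine norm_integral_le_of_norm_le integrable_exp_neg_sq_half (ae_of_all _ fun s => ?_)
    rw [norm_mul, norm_mul, Complex.norm_exp_ofReal_mul_I, one_mul, Complex.norm_real,
      Real.norm_of_nonneg (Real.exp_pos _).le]
    exact mul_le_of_le_one_right (Real.exp_pos _).le (norm_prod_tiltChar_le_one _ _ _ _)
  have h2 : ∫ s : ℝ, Real.exp (-(s ^ 2 / 2)) ≤ 2 * Real.pi := by
    have := integral_exp_neg_sq_half_mul (c := 0)
    simp only [mul_zero, neg_zero, Real.exp_zero, mul_one, add_zero, div_one] at this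
    rw [this, Real.sqrt_le_left (by positivity)]
    nlinarith [Real.pi_gt_three]
  calc Real.exp (-(b * z)) / (2 * Real.pi) * ‖_‖
      ≤ Real.exp (-(b * z)) / (2 * Real.pi) * (2 * Real.pi) := by
        gcongr
        exact h1.trans h2
    _ = Real.exp (-(b * z)) := by
        have := Real.pi_pos
        field_simp

/-- The properties of a realization `f` of the field that drive the asymptotics; `b N` is the
critical inverse temperature of the empirical measure of `f 0, …, f (N - 1)`. -/
structure IsTypicalField (f : ℕ → ℝ) (b : ℕ → ℝ) (β v : ℝ) : Prop where
  pos : 0 < β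
  tendsto : Tendsto b atTop (𝓝 β)
  balance : ∀ N : ℕ, N ≠ 0 →
    ∑ i : Fin N, entropyLoss (b N * f i) + N * (b N ^ 2 / 2) = N * Real.log 2
  moment : ∃ B : ℝ, ∀ N : ℕ, ∑ i : Fin N, (1 + f i ^ 4) ≤ B * N
  variance : Tendsto (fun N : ℕ => (∑ i : Fin N, f i ^ 2 / Real.cosh (b N * f i) ^ 2) / N) atTop
    (𝓝 v)

namespace IsTypicalField

variable {f b : ℕ → ℝ} {β v : ℝ}

theorem variance_nonneg (h : IsTypicalField f b β v) : 0 ≤ v :=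
  ge_of_tendsto' h.variance fun N => by positivity

/-- The central limit theorem for the tilted spins. -/
theorem tendsto_prod_tiltChar (h : IsTypicalField f b β v) (s : ℝ) :
    Tendsto (fun N : ℕ => ∏ i : Fin N, tiltChar (b N) (f i) (s / √N)) atTop
      (𝓝 (Real.exp (-(s ^ 2 / 2 * v)) : ℝ)) := by
  obtain ⟨B, hB⟩ := h.moment
  have hsq : Tendsto (fun N : ℕ => √(N : ℝ)) atTop atTop :=
    Real.tendsto_sqrt_atTop.comp tendsto_natCast_atTop_atTop
  have h1 : Tendsto (fun N : ℕ => ∏ i : Fin N, tiltChar (b N) (f i) (s / √N)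
      - (Real.exp (-((s / √N) ^ 2 / 2 * ∑ i : Fin N, f i ^ 2 / Real.cosh (b N * f i) ^ 2)) : ℝ))
      atTop (𝓝 0) := by
    have h2 : Tendsto (fun N : ℕ => (32 * |s| ^ 3 * (√(N : ℝ))⁻¹ + s ^ 4 * ((√(N : ℝ))⁻¹) ^ 2) * B)
        atTop (𝓝 0) := by
      have hi := tendsto_inv_atTop_zero.comp hsq
      have := ((hi.const_mul (32 * |s| ^ 3)).add ((hi.pow 2).const_mul (s ^ 4))).mul_const B
      simpa using this
    refine squeeze_zero_norm' ?_ h2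
    filter_upwards [eventually_gt_atTop 0] with N hN
    have hN' : (0 : ℝ) < N := by exact_mod_cast hN
    have hs0 : 0 < √(N : ℝ) := by positivity
    have hss : √(N : ℝ) ^ 2 = N := Real.sq_sqrt hN'.le
    refine (norm_prod_tiltChar_sub_le (b N) (s / √N) fun i : Fin N => f i).trans ?_
    calc (32 * |s / √N| ^ 3 + (s / √N) ^ 4) * ∑ i : Fin N, (1 + f i ^ 4)
        ≤ (32 * |s / √N| ^ 3 + (s / √N) ^ 4) * (B * N) := by
          gcongr
          exact hB N
      _ = _ := by
          rw [abs_div, abs_of_pos hs0]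
          have e : B * (N : ℝ) = B * √(N : ℝ) ^ 2 := by rw [hss]
          rw [e]
          field_simp
  have h3 : Tendsto (fun N : ℕ => Real.exp (-((s / √N) ^ 2 / 2 *
      ∑ i : Fin N, f i ^ 2 / Real.cosh (b N * f i) ^ 2))) atTop
      (𝓝 (Real.exp (-(s ^ 2 / 2 * v)))) := by
    refine ((Real.continuous_exp.tendsto _).comp (h.variance.const_mul (s ^ 2 / 2)).neg).congr
      fun N => ?_
    simp only [Function.comp_apply]
    congr 2
    rw [div_pow, Real.sq_sqrt (Nat.cast_nonneg N)]
    ring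
  have h4 := h1.add ((Complex.continuous_ofReal.tendsto _).comp h3)
  simpa using h4

theorem eventually_pos (h : IsTypicalField f b β v) :
    ∀ᶠ N in atTop, β / 2 ≤ b N ∧ b N ≤ 2 * β := by
  have := h.pos
  filter_upwards [h.tendsto.eventually (Ioo_mem_nhds (a := β / 2) (b := 2 * β) (by linarith)
    (by linarith))] with N hN using ⟨hN.1.le, hN.2.le⟩

/-- The local limit theorem for the level density. -/
theorem tendsto_levelDensity (h : IsTypicalField f b β v) (z : ℝ) :
    Tendsto (fun N : ℕ => levelDensity f N (z + tiltedLevel f N (b N))) atTop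
      (𝓝 (1 / √(2 * Real.pi * (1 + v)) * Real.exp (-β * z))) := by
  have hβ := h.pos
  have hv := h.variance_nonneg
  have hδ : Tendsto (fun N : ℕ => (z - Real.log N / (2 * b N)) / √(N : ℝ)) atTop (𝓝 0) := by
    have h1 : Tendsto (fun x : ℝ => Real.log x / √x) atTop (𝓝 0) := by
      have := (isLittleO_log_rpow_atTop (r := 1 / 2) (by norm_num)).tendsto_div_nhds_zero
      simpa [Real.sqrt_eq_rpow] using this
    have h2 := h1.comp tendsto_natCast_atTop_atTop
    have h3 : Tendsto (fun N : ℕ => z / √(N : ℝ)) atTop (𝓝 0) :=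
      tendsto_const_nhds.div_atTop (Real.tendsto_sqrt_atTop.comp tendsto_natCast_atTop_atTop)
    have h4 : Tendsto (fun N => 1 / (2 * b N)) atTop (𝓝 (1 / (2 * β))) :=
      tendsto_const_nhds.div (h.tendsto.const_mul 2) (by positivity)
    have h5 := h3.sub (h2.mul h4)
    simp only [Function.comp_apply, zero_mul, sub_zero] at h5
    refine h5.congr fun N => ?_
    ring
  have hint : Tendsto (fun N : ℕ =>
      ∫ s : ℝ, Complex.exp ((-(s * ((z - Real.log N / (2 * b N)) / √N)) : ℝ) * Complex.I) *
        (Real.exp (-(s ^ 2 / 2)) : ℝ) * ∏ i : Fin N, tiltChar (b N) (f i) (s / √N)) atTop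
      (𝓝 (∫ s : ℝ, Complex.exp ((-(s * 0) : ℝ) * Complex.I) *
        (Real.exp (-(s ^ 2 / 2)) : ℝ) * (Real.exp (-(s ^ 2 / 2 * v)) : ℝ))) := by
    refine tendsto_integral_of_dominated_convergence (fun s => Real.exp (-(s ^ 2 / 2)))
      (fun N => ?_) integrable_exp_neg_sq_half (fun N => ae_of_all _ fun s => ?_)
      (ae_of_all _ fun s => ?_)
    · have hc : ∀ i : Fin N, Continuous fun s : ℝ => tiltChar (b N) (f i) (s / √N) := fun i =>
        (continuous_tiltChar _ _).comp (continuous_id.div_const _)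
      exact Continuous.aestronglyMeasurable (by fun_prop)
    · rw [norm_mul, norm_mul, Complex.norm_exp_ofReal_mul_I, one_mul, Complex.norm_real,
        Real.norm_of_nonneg (Real.exp_pos _).le]
      exact mul_le_of_le_one_right (Real.exp_pos _).le (norm_prod_tiltChar_le_one _ _ _ _)
    · refine Tendsto.mul (Tendsto.mul_const _ ?_) (h.tendsto_prod_tiltChar s)
      have hc : Continuous fun δ : ℝ => Complex.exp ((-(s * δ) : ℝ) * Complex.I) := by fun_prop
      exact (hc.tendsto 0).comp hδ
  have hpre : Tendsto (fun N : ℕ => ((Real.exp (-(b N * z)) / (2 * Real.pi) : ℝ) : ℂ)) atTop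
      (𝓝 (Real.exp (-(β * z)) / (2 * Real.pi) : ℝ)) := by
    have hc : Continuous fun b : ℝ => ((Real.exp (-(b * z)) / (2 * Real.pi) : ℝ) : ℂ) := by fun_prop
    exact (hc.tendsto β).comp h.tendsto
  have hlim : ((Real.exp (-(β * z)) / (2 * Real.pi) : ℝ) : ℂ) *
      (∫ s : ℝ, Complex.exp ((-(s * 0) : ℝ) * Complex.I) *
        (Real.exp (-(s ^ 2 / 2)) : ℝ) * (Real.exp (-(s ^ 2 / 2 * v)) : ℝ))
      = (1 / √(2 * Real.pi * (1 + v)) * Real.exp (-β * z) : ℝ) := by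
    have e : ∀ s : ℝ, Complex.exp ((-(s * 0) : ℝ) * Complex.I) *
        (Real.exp (-(s ^ 2 / 2)) : ℝ) * (Real.exp (-(s ^ 2 / 2 * v)) : ℝ)
        = ((Real.exp (-(s ^ 2 / 2)) * Real.exp (-(s ^ 2 / 2 * v)) : ℝ) : ℂ) := by
      intro s
      simp
    simp_rw [e]
    rw [integral_complex_ofReal, integral_exp_neg_sq_half_mul, ← Complex.ofReal_mul]
    congr 1
    rw [Real.sqrt_div (by positivity), Real.sqrt_mul (by positivity) (1 + v), neg_mul]
    have h1 : √(2 * Real.pi) * √(2 * Real.pi) = 2 * Real.pi := Real.mul_self_sqrt (by positivity)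
    have h2 : 0 < √(2 * Real.pi) := by positivity
    have h3 : 0 < √(1 + v) := by positivity
    have := Real.pi_pos
    field_simp
    nlinarith
  have hmain := hpre.mul hint
  rw [hlim] at hmain
  suffices hc : Tendsto (fun N : ℕ => (levelDensity f N (z + tiltedLevel f N (b N)) : ℂ)) atTop
      (𝓝 (1 / √(2 * Real.pi * (1 + v)) * Real.exp (-β * z) : ℝ)) from
    (Complex.continuous_re.tendsto _).comp hc
  refine hmain.congr' ?_
  filter_upwards [h.eventually_pos, eventually_ne_atTop 0] with N hN hN0
  have hb0 : b N ≠ 0 := by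
    have := hN.1
    intro h0
    linarith
  rw [levelDensity_tiltedLevel f hN0 hb0 (h.balance N hN0)]

/-- A majorant of `levelDensity` on `[a, ∞)`, uniform in the system size. -/
def majorant (β a y : ℝ) : ℝ :=
  (Set.Ici a).indicator (fun y => 2 * (Real.exp (-(β / 2) * y) + Real.exp (-(2 * β) * y))) y

theorem majorant_nonneg (β a y : ℝ) : 0 ≤ majorant β a y :=
  Set.indicator_nonneg (fun _ _ => by positivity) _

theorem integrable_majorant {β : ℝ} (hβ : 0 < β) (a : ℝ) : Integrable (majorant β a) := by
  unfold majorant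
  rw [integrable_indicator_iff measurableSet_Ici, integrableOn_Ici_iff_integrableOn_Ioi]
  exact ((integrableOn_exp_mul_Ioi (by linarith) a).add
    (integrableOn_exp_mul_Ioi (by linarith) a)).const_mul 2

theorem eventually_levelDensity_le (h : IsTypicalField f b β v) (a : ℝ) :
    ∀ᶠ N : ℕ in atTop, N ≠ 0 ∧ ∀ y, a ≤ y →
      2 * levelDensity f N (y + tiltedLevel f N (b N)) ≤ majorant β a y := by
  filter_upwards [h.eventually_pos, eventually_ne_atTop 0] with N hN hN0
  have hβ := h.pos
  have hb0 : b N ≠ 0 := by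
    have := hN.1
    intro h0
    linarith
  refine ⟨hN0, fun y hy => ?_⟩
  rw [majorant, Set.indicator_of_mem (Set.mem_Ici.2 hy)]
  refine mul_le_mul_of_nonneg_left
    ((levelDensity_tiltedLevel_le f hN0 hb0 (h.balance N hN0) y).trans ?_) zero_le_two
  rcases le_total 0 y with h0 | h0
  · have : Real.exp (-(b N * y)) ≤ Real.exp (-(β / 2) * y) := by
      rw [Real.exp_le_exp]
      nlinarith [hN.1]
    linarith [Real.exp_pos (-(2 * β) * y)]
  · have : Real.exp (-(b N * y)) ≤ Real.exp (-(2 * β) * y) := by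
      rw [Real.exp_le_exp]
      nlinarith [hN.2]
    linarith [Real.exp_pos (-(β / 2) * y)]

theorem gaussianPDFReal_le_inv_sqrt (m y : ℝ) (N : ℕ) :
    gaussianPDFReal m N y ≤ (√(N : ℝ))⁻¹ := by
  rcases Nat.eq_zero_or_pos N with rfl | hN
  · simp [gaussianPDFReal]
  have hN' : (0 : ℝ) < N := by exact_mod_cast hN
  simp only [gaussianPDFReal, NNReal.coe_natCast]
  have h1 : Real.exp (-(y - m) ^ 2 / (2 * N)) ≤ 1 := by
    rw [Real.exp_le_one_iff]
    exact div_nonpos_of_nonpos_of_nonneg (by nlinarith [sq_nonneg (y - m)]) (by positivity)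
  have h2 : √(N : ℝ) ≤ √(2 * Real.pi * N) := by
    apply Real.sqrt_le_sqrt
    nlinarith [Real.pi_gt_three]
  calc _ ≤ (√(2 * Real.pi * N))⁻¹ * 1 := by gcongr
    _ ≤ (√(N : ℝ))⁻¹ := by
        rw [mul_one]
        gcongr

/-- Expectations of products over the energy levels converge to their Poissonian values. -/
theorem tendsto_prod_integral (h : IsTypicalField f b β v) {g : ℝ → ℂ} (hg : Measurable g)
    (hg2 : ∀ x, ‖g x‖ ≤ 2) (hg1 : ∀ x, ‖1 + g x‖ ≤ 1) {a : ℝ} (hga : ∀ x < a, g x = 0) :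
    Tendsto (fun N : ℕ => ∏ σ : Config N,
        ∫ x, (1 + g (x - tiltedLevel f N (b N))) ∂gaussianReal (spinSum f N σ) N) atTop
      (𝓝 (Complex.exp (∫ y,
        (1 / √(2 * Real.pi * (1 + v)) * Real.exp (-β * y) : ℝ) • g y))) := by
  set r : ℕ → ℝ := fun N => tiltedLevel f N (b N) with hr
  set A : ∀ N : ℕ, Config N → ℂ := fun N σ =>
    ∫ x, g (x - r N) ∂gaussianReal (spinSum f N σ) N with hA
  have hDi := integrable_majorant h.pos a
  have hint : ∀ N (σ : Config N), Integrable (fun x => g (x - r N))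
      (gaussianReal (spinSum f N σ) N) := fun N σ =>
    Integrable.of_bound (Measurable.aestronglyMeasurable (by fun_prop)) 2
      (ae_of_all _ fun x => hg2 _)
  have e1 : ∀ N (σ : Config N), ∫ x, (1 + g (x - r N)) ∂gaussianReal (spinSum f N σ) N
      = 1 + A N σ := by
    intro N σ
    rw [integral_add (integrable_const _) (hint N σ)]
    simp [hA]
  have hAi : ∀ N (σ : Config N), N ≠ 0 →
      A N σ = ∫ y, gaussianPDFReal (spinSum f N σ) N (y + r N) • g y := by
    intro N σ hN
    simp only [hA]
    rw [integral_gaussianReal_eq_integral_smul (by exact_mod_cast hN),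
      ← integral_add_right_eq_self
        (fun x => gaussianPDFReal (spinSum f N σ) N x • g (x - r N)) (r N)]
    simp_rw [add_sub_cancel_right]
  have hpi : ∀ N (σ : Config N),
      Integrable fun y => gaussianPDFReal (spinSum f N σ) N (y + r N) • g y := by
    intro N σ
    exact ((integrable_gaussianPDFReal (spinSum f N σ) N).comp_add_right (r N)).smul_bdd 2
      hg.aestronglyMeasurable (ae_of_all _ hg2)
  have hpt : ∀ N (σ : Config N) y, ‖gaussianPDFReal (spinSum f N σ) N (y + r N) • g y‖
      = gaussianPDFReal (spinSum f N σ) N (y + r N) * ‖g y‖ := fun N σ y => by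
    rw [norm_smul, Real.norm_of_nonneg (gaussianPDFReal_nonneg _ _ _)]
  have hsum : ∀ N y, (∑ σ : Config N, gaussianPDFReal (spinSum f N σ) N (y + r N))
      = levelDensity f N (y + r N) := fun N y => rfl
  -- the level density weighted by `g` is below the majorant
  have hdom : ∀ᶠ N : ℕ in atTop, N ≠ 0 ∧ ∀ y, levelDensity f N (y + r N) * ‖g y‖
      ≤ majorant β a y := by
    filter_upwards [h.eventually_levelDensity_le a] with N hN
    refine ⟨hN.1, fun y => ?_⟩
    by_cases hy : y < a
    · rw [hga y hy, norm_zero, mul_zero]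
      exact majorant_nonneg _ _ _
    · refine le_trans ?_ (hN.2 y (not_lt.1 hy))
      rw [mul_comm]
      exact mul_le_mul_of_nonneg_right (hg2 y) (levelDensity_nonneg _ _ _)
  have key := tendsto_prod_one_add (a := A) (K := ∫ y, majorant β a y)
    (ε := fun N : ℕ => ∫ y, min (2 * (√(N : ℝ))⁻¹) (majorant β a y))
    (l := ∫ y, (1 / √(2 * Real.pi * (1 + v)) * Real.exp (-β * y) : ℝ) • g y) ?_ ?_ ?_ ?_ ?_
  · exact key.congr fun N => Finset.prod_congr rfl fun σ _ => (e1 N σ).symm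
  · intro N σ
    rw [← e1]
    refine (norm_integral_le_of_norm_le_const (ae_of_all _ fun x => hg1 _)).trans ?_
    simp
  · filter_upwards [hdom] with N hN σ
    rw [hAi N σ hN.1]
    refine norm_integral_le_of_norm_le ?_ (ae_of_all _ fun y => ?_)
    · refine hDi.mono' ((aestronglyMeasurable_const).inf hDi.1) (ae_of_all _ fun y => ?_)
      rw [Real.norm_of_nonneg (le_min (by positivity) (majorant_nonneg _ _ _))]
      exact min_le_right _ _
    · rw [hpt]
      refine le_min ?_ ((mul_le_mul_of_nonneg_right ?_ (norm_nonneg _)).trans (hN.2 y))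
      · rw [mul_comm]
        exact mul_le_mul (hg2 y) (gaussianPDFReal_le_inv_sqrt _ _ _)
          (gaussianPDFReal_nonneg _ _ _) zero_le_two
      · rw [← hsum]
        exact Finset.single_le_sum (f := fun σ => gaussianPDFReal (spinSum f N σ) N (y + r N))
          (fun _ _ => gaussianPDFReal_nonneg _ _ _) (Finset.mem_univ σ)
  · have hz : (0 : ℝ) = ∫ _ : ℝ, (0 : ℝ) := by simp
    rw [hz]
    refine tendsto_integral_of_dominated_convergence (majorant β a)
      (fun N => (aestronglyMeasurable_const).inf hDi.1) hDi
      (fun N => ae_of_all _ fun y => ?_) (ae_of_all _ fun y => ?_)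
    · rw [Real.norm_of_nonneg (le_min (by positivity) (majorant_nonneg _ _ _))]
      exact min_le_right _ _
    · have h1 : Tendsto (fun N : ℕ => 2 * (√(N : ℝ))⁻¹) atTop (𝓝 0) := by
        have := (tendsto_inv_atTop_zero.comp
          (Real.tendsto_sqrt_atTop.comp tendsto_natCast_atTop_atTop)).const_mul (2 : ℝ)
        simpa using this
      have h2 := h1.min (tendsto_const_nhds (x := majorant β a y))
      rwa [min_eq_left (majorant_nonneg _ _ _)] at h2
  · filter_upwards [hdom] with N hN
    calc ∑ σ, ‖A N σ‖
        ≤ ∑ σ : Config N, ∫ y, ‖gaussianPDFReal (spinSum f N σ) N (y + r N) • g y‖ := by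
          refine Finset.sum_le_sum fun σ _ => ?_
          rw [hAi N σ hN.1]
          exact norm_integral_le_integral_norm _
      _ = ∫ y, levelDensity f N (y + r N) * ‖g y‖ := by
          rw [← integral_finsetSum _ fun σ _ => (hpi N σ).norm]
          simp_rw [hpt, ← Finset.sum_mul, hsum]
      _ ≤ ∫ y, majorant β a y := by
          refine integral_mono_of_nonneg (ae_of_all _ fun y => ?_) hDi (ae_of_all _ hN.2)
          exact mul_nonneg (levelDensity_nonneg _ _ _) (norm_nonneg _)
  · have hlim : Tendsto (fun N : ℕ => ∫ y, levelDensity f N (y + r N) • g y) atTop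
        (𝓝 (∫ y, (1 / √(2 * Real.pi * (1 + v)) * Real.exp (-β * y) : ℝ) • g y)) := by
      refine tendsto_integral_filter_of_dominated_convergence (majorant β a)
        (Eventually.of_forall fun N => ?_) ?_ hDi (ae_of_all _ fun y => ?_)
      · have hm : ∀ σ : Config N, Measurable (gaussianPDFReal (spinSum f N σ) N) :=
          fun σ => measurable_gaussianPDFReal _ _
        unfold levelDensity
        exact Measurable.aestronglyMeasurable (by fun_prop)
      · filter_upwards [hdom] with N hN
        refine ae_of_all _ fun y => ?_
        rw [norm_smul, Real.norm_of_nonneg (levelDensity_nonneg _ _ _)]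
        exact hN.2 y
      · exact (h.tendsto_levelDensity y).smul_const _
    refine hlim.congr' ?_
    filter_upwards [eventually_ne_atTop 0] with N hN
    simp_rw [hAi N _ hN]
    rw [← integral_finsetSum _ fun σ _ => hpi N σ]
    simp_rw [← Finset.sum_smul, hsum]

end IsTypicalField

/-! ### The critical inverse temperature and its empirical counterpart -/

theorem log_cosh_nonneg (u : ℝ) : 0 ≤ Real.log (Real.cosh u) := Real.log_nonneg (Real.one_le_cosh u)

theorem log_cosh_le_abs (u : ℝ) : Real.log (Real.cosh u) ≤ |u| := by
  rw [Real.log_le_iff_le_exp (Real.cosh_pos u), ← Real.cosh_abs, Real.cosh_eq]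
  have : Real.exp (-|u|) ≤ Real.exp |u| := Real.exp_le_exp.2 (by linarith [abs_nonneg u])
  linarith

theorem continuous_log_cosh : Continuous fun u => Real.log (Real.cosh u) :=
  Real.continuous_cosh.log fun u => (Real.cosh_pos u).ne'

theorem continuous_entropyLoss : Continuous entropyLoss :=
  (continuous_id.mul continuous_tanh).sub continuous_log_cosh

theorem entropyLoss_zero : entropyLoss 0 = 0 := by simp [entropyLoss]

theorem entropyLoss_abs (u : ℝ) : entropyLoss |u| = entropyLoss u := by
  rcases abs_choice u with h | h <;> rw [h]
  simp [entropyLoss]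

theorem hasDerivAt_entropyLoss (u : ℝ) : HasDerivAt entropyLoss (u / Real.cosh u ^ 2) u := by
  have h1 := (hasDerivAt_id u).mul (hasDerivAt_tanh u)
  have h2 := (Real.hasDerivAt_cosh u).log (Real.cosh_pos u).ne'
  refine HasDerivAt.congr_deriv (f := entropyLoss) (h1.sub h2) ?_
  rw [Real.tanh_eq_sinh_div_cosh]
  simp only [id]
  ring

theorem monotoneOn_entropyLoss : MonotoneOn entropyLoss (Set.Ici 0) := by
  refine monotoneOn_of_deriv_nonneg (convex_Ici 0) continuous_entropyLoss.continuousOn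
    (fun u _ => (hasDerivAt_entropyLoss u).differentiableAt.differentiableWithinAt) fun u hu => ?_
  rw [interior_Ici] at hu
  rw [(hasDerivAt_entropyLoss u).deriv]
  have : 0 < u := hu
  positivity

theorem entropyLoss_mul_le {b c : ℝ} (hb : 0 ≤ b) (hbc : b ≤ c) (x : ℝ) :
    entropyLoss (b * x) ≤ entropyLoss (c * x) := by
  have hc := hb.trans hbc
  rw [← entropyLoss_abs (b * x), ← entropyLoss_abs (c * x), abs_mul, abs_mul, abs_of_nonneg hb,
    abs_of_nonneg hc]
  exact monotoneOn_entropyLoss (Set.mem_Ici.2 (by positivity)) (Set.mem_Ici.2 (by positivity))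
    (by gcongr)

theorem abs_entropyLoss_le (u : ℝ) : |entropyLoss u| ≤ |u| := by
  have h0 : 0 ≤ entropyLoss u := by
    rw [← entropyLoss_abs, ← entropyLoss_zero]
    exact monotoneOn_entropyLoss (Set.mem_Ici.2 le_rfl) (Set.mem_Ici.2 (abs_nonneg u))
      (abs_nonneg u)
  rw [abs_of_nonneg h0]
  have h1 : u * Real.tanh u ≤ |u| := by
    refine (le_abs_self _).trans ?_
    rw [abs_mul]
    exact mul_le_of_le_one_right (abs_nonneg _) (abs_tanh_le_one u)
  rw [entropyLoss]
  linarith [log_cosh_nonneg u]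

/-- The quadratic term makes the balance function strictly increasing on `[0, ∞)`. -/
theorem add_sq_half_lt {Φ : ℝ → ℝ} (hm : MonotoneOn Φ (Set.Ici 0)) {b c : ℝ} (hb : 0 ≤ b)
    (hbc : b < c) : Φ b + b ^ 2 / 2 < Φ c + c ^ 2 / 2 := by
  have h1 := hm (Set.mem_Ici.2 hb) (Set.mem_Ici.2 (hb.trans hbc.le)) hbc.le
  have h2 : b ^ 2 < c ^ 2 := by gcongr
  linarith

theorem existsUnique_balance {Φ : ℝ → ℝ} (hc : Continuous Φ) (hm : MonotoneOn Φ (Set.Ici 0))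
    (h0 : Φ 0 = 0) : ∃! b, 0 ≤ b ∧ Φ b + b ^ 2 / 2 = Real.log 2 := by
  have hlog := Real.log_pos (one_lt_two (α := ℝ))
  have h2 : Real.log 2 ≤ Φ 2 + 2 ^ 2 / 2 := by
    have := hm (Set.mem_Ici.2 le_rfl) (Set.mem_Ici.2 zero_le_two) zero_le_two
    have := Real.log_two_lt_d9
    norm_num
    linarith
  obtain ⟨b, hb, hbe⟩ := intermediate_value_Icc (f := fun b => Φ b + b ^ 2 / 2)
    (zero_le_two : (0 : ℝ) ≤ 2) (by fun_prop) ⟨by simp [h0, hlog.le], h2⟩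
  refine ⟨b, ⟨hb.1, hbe⟩, fun c hc' => ?_⟩
  by_contra hne
  rcases lt_or_gt_of_ne hne with hlt | hlt
  · have := add_sq_half_lt hm hc'.1 hlt
    rw [hc'.2, show Φ b + b ^ 2 / 2 = Real.log 2 from hbe] at this
    exact lt_irrefl _ this
  · have := add_sq_half_lt hm hb.1 hlt
    rw [hc'.2, show Φ b + b ^ 2 / 2 = Real.log 2 from hbe] at this
    exact lt_irrefl _ this

/-- The entropy lost per spin in the field `f` at inverse temperature `b`. -/
def empiricalLoss (f : ℕ → ℝ) (N : ℕ) (b : ℝ) : ℝ := (∑ i : Fin N, entropyLoss (b * f i)) / N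

theorem monotoneOn_empiricalLoss (f : ℕ → ℝ) (N : ℕ) :
    MonotoneOn (empiricalLoss f N) (Set.Ici 0) := fun b hb c _ hbc => by
  unfold empiricalLoss
  gcongr
  exact entropyLoss_mul_le hb hbc _

theorem existsUnique_empirical (f : ℕ → ℝ) (N : ℕ) :
    ∃! b, 0 ≤ b ∧ empiricalLoss f N b + b ^ 2 / 2 = Real.log 2 := by
  refine existsUnique_balance ?_ (monotoneOn_empiricalLoss f N) (by
    simp [empiricalLoss, entropyLoss_zero])
  have := continuous_entropyLoss
  unfold empiricalLoss
  fun_prop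

/-- The critical inverse temperature of the empirical measure of `f 0, …, f (N - 1)`: the
nonnegative `b` at which `empiricalLoss f N b + b ^ 2 / 2 = log 2`. -/
def empiricalBeta (N : ℕ) (f : ℕ → ℝ) : ℝ := (existsUnique_empirical f N).choose

theorem empiricalBeta_nonneg (N : ℕ) (f : ℕ → ℝ) : 0 ≤ empiricalBeta N f :=
  (existsUnique_empirical f N).choose_spec.1.1

theorem empiricalBeta_spec (N : ℕ) (f : ℕ → ℝ) :
    empiricalLoss f N (empiricalBeta N f) + empiricalBeta N f ^ 2 / 2 = Real.log 2 :=
  (existsUnique_empirical f N).choose_spec.1.2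

theorem sum_entropyLoss_empiricalBeta (f : ℕ → ℝ) {N : ℕ} (hN : N ≠ 0) :
    ∑ i : Fin N, entropyLoss (empiricalBeta N f * f i) + N * (empiricalBeta N f ^ 2 / 2)
      = N * Real.log 2 := by
  have hN' : (N : ℝ) ≠ 0 := by exact_mod_cast hN
  have := congrArg (fun x => (N : ℝ) * x) (empiricalBeta_spec N f)
  simp only [mul_add, empiricalLoss, mul_div_cancel₀ _ hN'] at this
  exact this

/-- The sublevel sets of `empiricalBeta`, on which its measurability rests. -/
theorem empiricalBeta_le_iff (N : ℕ) (f : ℕ → ℝ) {c : ℝ} (hc : 0 ≤ c) :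
    empiricalBeta N f ≤ c ↔ Real.log 2 ≤ empiricalLoss f N c + c ^ 2 / 2 := by
  have hm := monotoneOn_empiricalLoss f N
  constructor
  · intro h
    rw [← empiricalBeta_spec N f]
    rcases h.eq_or_lt with h | h
    · rw [h]
    · exact (add_sq_half_lt hm (empiricalBeta_nonneg N f) h).le
  · intro h
    by_contra! h'
    have := add_sq_half_lt hm hc h'
    rw [empiricalBeta_spec] at this
    linarith

theorem measurable_empiricalBeta (N : ℕ) : Measurable (empiricalBeta N) := by
  refine measurable_of_Iic fun c => ?_
  rcases lt_or_ge c 0 with hc | hc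
  · convert MeasurableSet.empty
    refine Set.eq_empty_of_forall_notMem fun f hf => ?_
    exact (hc.trans_le (empiricalBeta_nonneg N f)).not_ge hf
  · have e : empiricalBeta N ⁻¹' Set.Iic c
        = {f | Real.log 2 ≤ empiricalLoss f N c + c ^ 2 / 2} := by
      ext f
      exact empiricalBeta_le_iff N f hc
    rw [e]
    have := continuous_entropyLoss.measurable
    refine measurableSet_le measurable_const ?_
    unfold empiricalLoss
    fun_prop

/-! ### Laws of large numbers for the field -/

section Field

variable {Ω : Type*} [MeasurableSpace Ω] {P : Measure Ω} [IsProbabilityMeasure P]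
  {h : ℕ → Ω → ℝ} {X : (N : ℕ) → Config N → Ω → ℝ}

theorem integrable_one_add_pow_four (hm : IsREMInRandomField P h X) :
    Integrable (fun ω => 1 + h 0 ω ^ 4) P := by
  have hmeas := hm.measurable_field 0
  have h1 := hm.integrable_exp_field 1
  have h2 := hm.integrable_exp_field (-1)
  refine (integrable_const 1).add (((h1.add h2).const_mul 24).mono'
    (Measurable.aestronglyMeasurable (by fun_prop)) (ae_of_all _ fun ω => ?_))
  rw [Real.norm_of_nonneg (by positivity)]
  have h3 := Real.pow_div_factorial_le_exp |h 0 ω| (abs_nonneg _) 4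
  rw [Even.pow_abs (by decide), div_le_iff₀ (by positivity)] at h3
  have h4 : Real.exp |h 0 ω| ≤ Real.exp (1 * h 0 ω) + Real.exp (-1 * h 0 ω) := by
    rcases abs_choice (h 0 ω) with h' | h' <;> rw [h']
    · simpa using (Real.exp_pos _).le
    · simpa using (Real.exp_pos _).le
  have h5 : ((Nat.factorial 4 : ℕ) : ℝ) = 24 := by norm_num [Nat.factorial]
  rw [h5] at h3
  simp only [Pi.add_apply]
  linarith

theorem abs_le_one_add_pow_four (x : ℝ) : |x| ≤ 1 + x ^ 4 := by
  rw [abs_le]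
  constructor <;> nlinarith [sq_nonneg (x ^ 2 - 1), sq_nonneg (x - 1), sq_nonneg (x + 1)]

theorem sq_le_one_add_pow_four (x : ℝ) : x ^ 2 ≤ 1 + x ^ 4 := by
  nlinarith [sq_nonneg (x ^ 2 - 1)]

theorem abs_pow_three_le (x : ℝ) : x ^ 2 * |x| ≤ 1 + x ^ 4 := by
  nlinarith [sq_nonneg (|x| - 1), sq_abs x, abs_nonneg x, sq_nonneg (x ^ 2 - |x|),
    sq_nonneg (x ^ 2 - 1)]

/-- Observables of polynomial growth of degree four are integrable. -/
theorem integrable_of_le_one_add_pow_four (hm : IsREMInRandomField P h X) {φ : ℝ → ℝ}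
    (hφ : Continuous φ) {c : ℝ} (hc : ∀ x, |φ x| ≤ c * (1 + x ^ 4)) :
    Integrable (fun ω => φ (h 0 ω)) P :=
  ((integrable_one_add_pow_four hm).const_mul c).mono'
    (hφ.measurable.comp (hm.measurable_field 0)).aestronglyMeasurable
    (ae_of_all _ fun _ => hc _)

theorem tendsto_empirical_average (hm : IsREMInRandomField P h X) {φ : ℝ → ℝ}
    (hφ : Continuous φ) {c : ℝ} (hc : ∀ x, |φ x| ≤ c * (1 + x ^ 4)) :
    ∀ᵐ ω ∂P, Tendsto (fun N : ℕ => (∑ i : Fin N, φ (h i ω)) / N) atTop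
      (𝓝 (∫ ω, φ (h 0 ω) ∂P)) := by
  have := strong_law_ae_real (μ := P) (fun i ω => φ (h i ω))
    (integrable_of_le_one_add_pow_four hm hφ hc)
    (fun i j hij => (hm.indep_field.indepFun hij).comp hφ.measurable hφ.measurable)
    (fun i => (hm.identDistrib_field i).comp hφ.measurable)
  filter_upwards [this] with ω hω
  simpa only [Finset.sum_range] using hω

theorem abs_entropyLoss_mul_le (b x : ℝ) : |entropyLoss (b * x)| ≤ |b| * (1 + x ^ 4) := by
  refine (abs_entropyLoss_le _).trans ?_
  rw [abs_mul]
  exact mul_le_mul_of_nonneg_left (abs_le_one_add_pow_four x) (abs_nonneg b)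

theorem abs_mul_tanh_le (b x : ℝ) : |x * Real.tanh (b * x)| ≤ 1 * (1 + x ^ 4) := by
  rw [abs_mul, one_mul]
  exact (mul_le_of_le_one_right (abs_nonneg _) (abs_tanh_le_one _)).trans
    (abs_le_one_add_pow_four x)

theorem abs_log_cosh_mul_le (b x : ℝ) :
    |Real.log (Real.cosh (b * x))| ≤ |b| * (1 + x ^ 4) := by
  rw [abs_of_nonneg (log_cosh_nonneg _)]
  refine (log_cosh_le_abs _).trans ?_
  rw [abs_mul]
  exact mul_le_mul_of_nonneg_left (abs_le_one_add_pow_four x) (abs_nonneg b)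

theorem abs_sq_div_cosh_sq_le (b x : ℝ) :
    |x ^ 2 / Real.cosh (b * x) ^ 2| ≤ 1 * (1 + x ^ 4) := by
  rw [abs_of_nonneg (by positivity), one_mul]
  exact (div_le_self (sq_nonneg _) (one_le_pow₀ (Real.one_le_cosh _))).trans
    (sq_le_one_add_pow_four x)

theorem continuous_sq_div_cosh_sq (b : ℝ) : Continuous fun x => x ^ 2 / Real.cosh (b * x) ^ 2 := by
  refine Continuous.div (by fun_prop) ?_ fun x => (pow_pos (Real.cosh_pos _) 2).ne'
  exact (Real.continuous_cosh.comp (continuous_const.mul continuous_id)).pow 2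

theorem continuous_mul_tanh (b : ℝ) : Continuous fun x => x * Real.tanh (b * x) :=
  continuous_id.mul (continuous_tanh.comp (continuous_const.mul continuous_id))

theorem continuous_log_cosh_mul (b : ℝ) : Continuous fun x => Real.log (Real.cosh (b * x)) :=
  continuous_log_cosh.comp (continuous_const.mul continuous_id)

theorem continuous_entropyLoss_mul (b : ℝ) : Continuous fun x => entropyLoss (b * x) :=
  continuous_entropyLoss.comp (continuous_const.mul continuous_id)

variable (P h) in
/-- The mean entropy lost per spin at inverse temperature `b`. -/
def meanLoss (b : ℝ) : ℝ := ∫ ω, entropyLoss (b * h 0 ω) ∂P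

theorem meanLoss_eq (hm : IsREMInRandomField P h X) (b : ℝ) :
    meanLoss P h b = b * ∫ ω, h 0 ω * Real.tanh (b * h 0 ω) ∂P
      - ∫ ω, Real.log (Real.cosh (b * h 0 ω)) ∂P := by
  have h1 := integrable_of_le_one_add_pow_four hm (continuous_mul_tanh b) (abs_mul_tanh_le b)
  have h2 := integrable_of_le_one_add_pow_four hm
    (continuous_log_cosh_mul b) (abs_log_cosh_mul_le b)
  rw [← integral_const_mul, ← integral_sub (h1.const_mul b) h2]
  refine integral_congr_ae (ae_of_all _ fun ω => ?_)
  simp only [entropyLoss]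
  ring

theorem isCriticalBeta_iff (hm : IsREMInRandomField P h X) (b : ℝ) :
    IsCriticalBeta P h b ↔ 0 ≤ b ∧ meanLoss P h b + b ^ 2 / 2 = Real.log 2 := by
  rw [IsCriticalBeta, ← meanLoss_eq hm]
  constructor
  · intro hb
    have hb0 : 0 ≤ b := by
      rw [hb]
      exact Real.sqrt_nonneg _
    refine ⟨hb0, ?_⟩
    by_cases hneg : 0 ≤ 2 * (Real.log 2 - meanLoss P h b)
    · have := Real.sq_sqrt hneg
      rw [← hb] at this
      linarith
    · -- a negative radicand would force `b = 0`, where the radicand is `2 log 2`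
      exfalso
      rw [Real.sqrt_eq_zero_of_nonpos (by linarith)] at hb
      subst hb
      apply hneg
      simp only [meanLoss, zero_mul, entropyLoss_zero, integral_zero, sub_zero]
      linarith [Real.log_pos (one_lt_two (α := ℝ))]
  · rintro ⟨hb0, hb⟩
    rw [show 2 * (Real.log 2 - meanLoss P h b) = b ^ 2 by linarith, Real.sqrt_sq hb0]

theorem existsUnique_isCriticalBeta (hm : IsREMInRandomField P h X) :
    ∃! b, IsCriticalBeta P h b := by
  simp_rw [isCriticalBeta_iff hm]
  refine existsUnique_balance ?_ (fun b hb c _ hbc => ?_) ?_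
  · refine continuous_iff_continuousAt.2 fun b => ?_
    refine continuousAt_of_dominated (bound := fun ω => (|b| + 1) * (1 + h 0 ω ^ 4))
      (Eventually.of_forall fun c => ?_) ?_ ((integrable_one_add_pow_four hm).const_mul _)
      (ae_of_all _ fun ω => ?_)
    · exact ((continuous_entropyLoss_mul c).measurable.comp
        (hm.measurable_field 0)).aestronglyMeasurable
    · have : ∀ᶠ c in 𝓝 b, |c| < |b| + 1 :=
        continuous_abs.continuousAt.eventually_lt continuousAt_const (by simp)
      filter_upwards [this] with c hc
      refine ae_of_all _ fun ω => (abs_entropyLoss_mul_le c _).trans ?_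
      gcongr
    · exact (continuous_entropyLoss.comp (continuous_id.mul continuous_const)).continuousAt
  · refine integral_mono ?_ ?_ fun ω => entropyLoss_mul_le hb hbc _
    · exact integrable_of_le_one_add_pow_four hm (continuous_entropyLoss_mul b)
        (abs_entropyLoss_mul_le b)
    · exact integrable_of_le_one_add_pow_four hm (continuous_entropyLoss_mul c)
        (abs_entropyLoss_mul_le c)
  · simp [meanLoss, entropyLoss_zero]

theorem pos_of_isCriticalBeta (hm : IsREMInRandomField P h X) {β : ℝ}
    (hβ : IsCriticalBeta P h β) : 0 < β := by
  obtain ⟨h0, h1⟩ := (isCriticalBeta_iff hm β).1 hβ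
  refine h0.lt_of_ne fun h2 => ?_
  subst h2
  simp only [meanLoss, zero_mul, entropyLoss_zero, integral_zero] at h1
  have := Real.log_pos (one_lt_two (α := ℝ))
  have h3 : Real.log 2 = 0 := by
    rw [← h1]
    norm_num
  linarith

/-- Since `b ↦ empiricalLoss f N b` is nondecreasing, the defect of `β` in the empirical balance
equation controls the distance of `empiricalBeta` to `β`. -/
theorem abs_empiricalBeta_sq_sub_le (f : ℕ → ℝ) (N : ℕ) {β : ℝ} (hβ : 0 ≤ β) {l : ℝ}
    (hl : l + β ^ 2 / 2 = Real.log 2) :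
    |empiricalBeta N f ^ 2 - β ^ 2| ≤ 2 * |empiricalLoss f N β - l| := by
  have hs := empiricalBeta_spec N f
  have hb := empiricalBeta_nonneg N f
  have hm := monotoneOn_empiricalLoss f N
  rcases le_total (empiricalBeta N f) β with hle | hle
  · have := hm (Set.mem_Ici.2 hb) (Set.mem_Ici.2 hβ) hle
    have h2 : empiricalBeta N f ^ 2 ≤ β ^ 2 := by gcongr
    rw [abs_of_nonpos (by linarith)]
    linarith [le_abs_self (empiricalLoss f N β - l)]
  · have := hm (Set.mem_Ici.2 hβ) (Set.mem_Ici.2 hb) hle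
    have h2 : β ^ 2 ≤ empiricalBeta N f ^ 2 := by gcongr
    rw [abs_of_nonneg (by linarith)]
    linarith [neg_abs_le (empiricalLoss f N β - l)]

theorem tendsto_empiricalBeta {f : ℕ → ℝ} {β l : ℝ} (hβ : 0 ≤ β)
    (hl : l + β ^ 2 / 2 = Real.log 2)
    (hf : Tendsto (fun N => empiricalLoss f N β) atTop (𝓝 l)) :
    Tendsto (fun N => empiricalBeta N f) atTop (𝓝 β) := by
  have h1 : Tendsto (fun N => 2 * |empiricalLoss f N β - l|) atTop (𝓝 0) := by
    simpa using (hf.sub_const l).abs.const_mul 2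
  have h2 : Tendsto (fun N => empiricalBeta N f ^ 2) atTop (𝓝 (β ^ 2)) := by
    rw [tendsto_iff_norm_sub_tendsto_zero]
    exact squeeze_zero (fun N => norm_nonneg _)
      (fun N => abs_empiricalBeta_sq_sub_le f N hβ hl) h1
  have h3 := (Real.continuous_sqrt.tendsto _).comp h2
  rw [Real.sqrt_sq hβ] at h3
  exact h3.congr fun N => Real.sqrt_sq (empiricalBeta_nonneg N f)

/-- Empirical averages at a convergent sequence of inverse temperatures. -/
theorem tendsto_average_of_tendsto {f b : ℕ → ℝ} {β l B : ℝ} {F : ℝ → ℝ → ℝ}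
    (hF : ∀ b c x, |F b x - F c x| ≤ 2 * |b - c| * (1 + x ^ 4))
    (hb : Tendsto b atTop (𝓝 β)) (hB : ∀ N : ℕ, ∑ i : Fin N, (1 + f i ^ 4) ≤ B * N)
    (hl : Tendsto (fun N : ℕ => (∑ i : Fin N, F β (f i)) / N) atTop (𝓝 l)) :
    Tendsto (fun N : ℕ => (∑ i : Fin N, F (b N) (f i)) / N) atTop (𝓝 l) := by
  have h1 : Tendsto (fun N => 2 * |b N - β| * B) atTop (𝓝 0) := by
    simpa using ((hb.sub_const β).abs.const_mul 2).mul_const B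
  have h2 : Tendsto (fun N : ℕ => (∑ i : Fin N, F (b N) (f i)) / N
      - (∑ i : Fin N, F β (f i)) / N) atTop (𝓝 0) := by
    refine squeeze_zero_norm' ?_ h1
    filter_upwards [eventually_gt_atTop 0] with N hN
    have hN' : (0 : ℝ) < N := by exact_mod_cast hN
    rw [← sub_div, ← Finset.sum_sub_distrib, Real.norm_eq_abs, abs_div, abs_of_pos hN',
      div_le_iff₀ hN', mul_assoc]
    calc |∑ i : Fin N, (F (b N) (f i) - F β (f i))|
        ≤ ∑ i : Fin N, 2 * |b N - β| * (1 + f i ^ 4) :=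
          (Finset.abs_sum_le_sum_abs _ _).trans (Finset.sum_le_sum fun i _ => hF _ _ _)
      _ = 2 * |b N - β| * ∑ i : Fin N, (1 + f i ^ 4) := (Finset.mul_sum _ _ _).symm
      _ ≤ 2 * |b N - β| * (B * N) := by
          gcongr
          exact hB N
  simpa using h2.add hl

theorem abs_mul_tanh_sub_le (b c x : ℝ) :
    |x * Real.tanh (b * x) - x * Real.tanh (c * x)| ≤ 2 * |b - c| * (1 + x ^ 4) := by
  rw [← mul_sub, abs_mul]
  have h1 := abs_tanh_sub_tanh_le (b * x) (c * x)
  rw [← sub_mul, abs_mul] at h1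
  calc |x| * |Real.tanh (b * x) - Real.tanh (c * x)| ≤ |x| * (|b - c| * |x|) := by gcongr
    _ = |b - c| * x ^ 2 := by rw [← sq_abs x]; ring
    _ ≤ |b - c| * (1 + x ^ 4) := by
        gcongr
        exact sq_le_one_add_pow_four x
    _ ≤ 2 * |b - c| * (1 + x ^ 4) := by
        gcongr
        linarith [abs_nonneg (b - c)]

theorem abs_sq_div_cosh_sq_sub_le (b c x : ℝ) :
    |x ^ 2 / Real.cosh (b * x) ^ 2 - x ^ 2 / Real.cosh (c * x) ^ 2|
      ≤ 2 * |b - c| * (1 + x ^ 4) := by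
  have h1 := abs_inv_cosh_sq_sub_le (b * x) (c * x)
  rw [← sub_mul, abs_mul] at h1
  rw [div_eq_mul_one_div, div_eq_mul_one_div (x ^ 2) (Real.cosh (c * x) ^ 2), ← mul_sub, abs_mul,
    abs_of_nonneg (sq_nonneg x)]
  calc _ ≤ x ^ 2 * (2 * (|b - c| * |x|)) := by gcongr
    _ = 2 * |b - c| * (x ^ 2 * |x|) := by ring
    _ ≤ 2 * |b - c| * (1 + x ^ 4) := by
        gcongr
        exact abs_pow_three_le x

/-- The averages whose convergence makes a realization of the field typical are all taken at the
single inverse temperature `β`. -/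
theorem isTypicalField_of_tendsto {f : ℕ → ℝ} {β l v w : ℝ} (hβ : 0 < β)
    (hl : l + β ^ 2 / 2 = Real.log 2) (h1 : Tendsto (fun N => empiricalLoss f N β) atTop (𝓝 l))
    (h3 : Tendsto (fun N : ℕ => (∑ i : Fin N, f i ^ 2 / Real.cosh (β * f i) ^ 2) / N) atTop (𝓝 v))
    (h4 : Tendsto (fun N : ℕ => (∑ i : Fin N, (1 + f i ^ 4)) / (N : ℝ)) atTop (𝓝 w)) :
    IsTypicalField f (fun N => empiricalBeta N f) β v := by
  have hb := tendsto_empiricalBeta hβ.le hl h1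
  have hB : ∃ B : ℝ, ∀ N : ℕ, ∑ i : Fin N, (1 + f i ^ 4) ≤ B * N := by
    obtain ⟨B, hB⟩ := h4.bddAbove_range
    refine ⟨B, fun N => ?_⟩
    rcases Nat.eq_zero_or_pos N with rfl | hN
    · simp
    · rw [← div_le_iff₀ (by exact_mod_cast hN)]
      exact hB (Set.mem_range_self N)
  refine ⟨hβ, hb, fun N hN => sum_entropyLoss_empiricalBeta f hN, hB, ?_⟩
  obtain ⟨B, hB⟩ := hB
  exact tendsto_average_of_tendsto (F := fun b x => x ^ 2 / Real.cosh (b * x) ^ 2)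
    abs_sq_div_cosh_sq_sub_le hb hB h3

theorem IsTypicalField.tendsto_average_mul_tanh {f b : ℕ → ℝ} {β v l : ℝ}
    (hf : IsTypicalField f b β v)
    (h2 : Tendsto (fun N : ℕ => (∑ i : Fin N, f i * Real.tanh (β * f i)) / N) atTop (𝓝 l)) :
    Tendsto (fun N : ℕ => (∑ i : Fin N, f i * Real.tanh (b N * f i)) / N) atTop (𝓝 l) := by
  obtain ⟨B, hB⟩ := hf.moment
  exact tendsto_average_of_tendsto (F := fun b x => x * Real.tanh (b * x))
    abs_mul_tanh_sub_le hf.tendsto hB h2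

/-- Almost every realization of the field is typical, and the mean magnetic energy per spin
converges along `empiricalBeta`. -/
theorem ae_isTypicalField (hm : IsREMInRandomField P h X) {β : ℝ} (hβ : IsCriticalBeta P h β) :
    ∀ᵐ ω ∂P, IsTypicalField (fun i => h i ω) (fun N => empiricalBeta N fun i => h i ω) β
        (∫ ω, h 0 ω ^ 2 / Real.cosh (β * h 0 ω) ^ 2 ∂P) ∧
      Tendsto (fun N : ℕ =>
        (∑ i : Fin N, h i ω * Real.tanh ((empiricalBeta N fun i => h i ω) * h i ω)) / N) atTop
        (𝓝 (∫ ω, h 0 ω * Real.tanh (β * h 0 ω) ∂P)) := by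
  obtain ⟨hβ0, hbal⟩ := (isCriticalBeta_iff hm β).1 hβ
  filter_upwards [tendsto_empirical_average hm (continuous_entropyLoss_mul β)
      (abs_entropyLoss_mul_le β),
    tendsto_empirical_average hm (continuous_mul_tanh β) (abs_mul_tanh_le β),
    tendsto_empirical_average hm (continuous_sq_div_cosh_sq β) (abs_sq_div_cosh_sq_le β),
    tendsto_empirical_average hm (φ := fun x => 1 + x ^ 4) (by fun_prop) (c := 1)
      (fun x => by rw [abs_of_nonneg (by positivity), one_mul])] with ω h1 h2 h3 h4
  have hT := isTypicalField_of_tendsto (f := fun i => h i ω) (pos_of_isCriticalBeta hm hβ) hbal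
    h1 h3 h4
  exact ⟨hT, hT.tendsto_average_mul_tanh h2⟩

end Field

/-! ### The quenched law of the energies -/

section Quenched

variable {Ω : Type*} [MeasurableSpace Ω] {P : Measure Ω} [IsProbabilityMeasure P]
  {h : ℕ → Ω → ℝ} {X : (N : ℕ) → Config N → Ω → ℝ}

theorem map_rem_eq_pi (hm : IsREMInRandomField P h X) (N : ℕ) :
    P.map (fun ω σ => X N σ ω) = Measure.pi fun _ : Config N => gaussianReal 0 N := by
  rw [(iIndepFun_iff_map_fun_eq_pi_map fun σ => (hm.measurable_rem N σ).aemeasurable).1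
    (hm.indep_rem N)]
  congr 1
  funext σ
  exact (hm.hasLaw_rem N σ).map_eq

/-- Given the field, the energies are independent Gaussians of variance `N` with means
`spinSum f N σ`. -/
theorem ae_quenchedLaw_eq (hm : IsREMInRandomField P h X) (N : ℕ) :
    ∀ᵐ ω ∂P, quenchedLaw P h X N (fun i => h i ω)
      = Measure.pi fun σ => gaussianReal (spinSum (fun i => h i ω) N σ) N := by
  set ν : Measure (Config N → ℝ) := Measure.pi fun _ => gaussianReal 0 N with hν
  have hfield : Measurable fun ω (i : ℕ) => h i ω := measurable_pi_lambda _ hm.measurable_field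
  have hrem : Measurable fun ω (σ : Config N) => X N σ ω :=
    measurable_pi_lambda _ (hm.measurable_rem N)
  let T : (ℕ → ℝ) × (Config N → ℝ) → (Config N → ℝ) := fun p σ => p.2 σ + spinSum p.1 N σ
  have hT : Measurable T := by
    unfold T spinSum
    fun_prop
  let κ : Kernel (ℕ → ℝ) (Config N → ℝ) := (Kernel.id ×ₖ Kernel.const (ℕ → ℝ) ν).map T
  have hκ : ∀ f, κ f = ν.map fun x => T (f, x) := by
    intro f
    rw [Kernel.map_apply _ hT, Kernel.prod_apply, Kernel.id_apply, Kernel.const_apply,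
      Measure.dirac_prod, Measure.map_map hT measurable_prodMk_left]
    rfl
  have : IsMarkovKernel κ := Kernel.IsMarkovKernel.map _ hT
  have hjoint : P.map (fun ω => ((fun i => h i ω : ℕ → ℝ), fun σ => X N σ ω))
      = (P.map fun ω i => h i ω).prod ν := by
    rw [hν, ← map_rem_eq_pi hm N]
    exact (indepFun_iff_map_prod_eq_prod_map_map hfield.aemeasurable hrem.aemeasurable).1
      (hm.indep_rem_field N).symm
  have hH : (fun ω => ((fun i => h i ω : ℕ → ℝ), fun σ => hamiltonian h X N σ ω))
      = (fun p : (ℕ → ℝ) × (Config N → ℝ) => (p.1, T p)) ∘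
        fun ω => ((fun i => h i ω : ℕ → ℝ), fun σ => X N σ ω) := rfl
  have hS : Measurable fun p : (ℕ → ℝ) × (Config N → ℝ) => (p.1, T p) := measurable_fst.prodMk hT
  have hcond := condDistrib_ae_eq_of_measure_eq_compProd (μ := P)
    (Y := fun ω σ => hamiltonian h X N σ ω) (fun ω (i : ℕ) => h i ω) (κ := κ)
    (by
      have : Measurable fun ω => ((fun i => h i ω : ℕ → ℝ), fun σ => X N σ ω) :=
        hfield.prodMk hrem
      exact (hT.comp this).aemeasurable)
    (by
      rw [hH, ← Measure.map_map hS (hfield.prodMk hrem), hjoint]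
      have hfp : IsProbabilityMeasure (P.map fun ω (i : ℕ) => h i ω) :=
        Measure.isProbabilityMeasure_map hfield.aemeasurable
      ext s hs
      rw [Measure.map_apply hS hs, Measure.prod_apply (hS hs), Measure.compProd_apply hs]
      refine lintegral_congr fun f => ?_
      rw [hκ, Measure.map_apply (by fun_prop) (measurable_prodMk_left hs)]
      rfl)
  filter_upwards [ae_of_ae_map hfield.aemeasurable hcond] with ω hω
  rw [quenchedLaw, hω, hκ, hν]
  have := Measure.pi_map_pi (μ := fun _ : Config N => gaussianReal 0 N)
    (f := fun σ x => x + spinSum (fun i => h i ω) N σ) (fun σ => by fun_prop)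
  refine this.trans ?_
  congr 1
  funext σ
  rw [gaussianReal_map_add_const, zero_add]

end Quenched

/-! ### Convergence to the Poisson process and of the maximum -/

theorem isLocallyFiniteMeasure_expIntensity (C β : ℝ) :
    IsLocallyFiniteMeasure (expIntensity C β) :=
  IsLocallyFiniteMeasure.withDensity_ofReal (by fun_prop)

theorem integral_expIntensity {C : ℝ} (hC : 0 ≤ C) (β : ℝ) (g : ℝ → ℂ) :
    ∫ y, g y ∂expIntensity C β = ∫ y, (C * Real.exp (-β * y)) • g y := by
  rw [expIntensity, integral_withDensity_eq_integral_toReal_smul (by fun_prop)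
    (ae_of_all _ fun _ => ENNReal.ofReal_lt_top)]
  refine integral_congr_ae (ae_of_all _ fun y => ?_)
  simp only
  rw [ENNReal.toReal_ofReal (by positivity)]

/-- Convergence of the recentered energy levels, through their characteristic functionals. -/
theorem tendstoInDistribution_ofPoints {f b : ℕ → ℝ} {β v : ℝ} (hf : IsTypicalField f b β v)
    {μ : (N : ℕ) → Measure (Config N → ℝ)} [∀ N, IsProbabilityMeasure (μ N)]
    (hμ : ∀ N, μ N = Measure.pi fun σ => gaussianReal (spinSum f N σ) N)
    {Q : ProbabilityMeasure LocFinMeasure}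
    (hQ : ∀ g, IsBoundedTest g →
      ∫ ξ, Complex.exp ((∫ x, g x ∂ξ.toMeasure : ℝ) * Complex.I) ∂(Q : Measure LocFinMeasure)
        = Complex.exp (∫ x, (Complex.exp (g x * Complex.I) - 1)
            ∂expIntensity (1 / √(2 * Real.pi * (1 + v))) β)) :
    TendstoInDistribution
      (fun (N : ℕ) (H : Config N → ℝ) =>
        LocFinMeasure.ofPoints fun σ => H σ - tiltedLevel f N (b N))
      atTop (fun ξ => ξ) μ (Q : Measure LocFinMeasure) := by
  have hmeas : ∀ N, Measurable fun H : Config N → ℝ =>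
      LocFinMeasure.ofPoints fun σ => H σ - tiltedLevel f N (b N) := fun N =>
    LocFinMeasure.measurable_ofPoints.comp (by fun_prop)
  refine ⟨fun N => (hmeas N).aemeasurable, aemeasurable_id, ?_⟩
  refine LocFinMeasure.tendsto_of_tendsto_charFunctional fun φ => ?_
  have hφ := IsBoundedTest.of_compactlySupported φ
  have hφm := hφ.measurable
  have hφi := hφ.measurable_integral
  obtain ⟨R, hR⟩ := hφ.vanishing
  have hlim := hf.tendsto_prod_integral (g := fun x => Complex.exp (φ x * Complex.I) - 1)
    (by fun_prop) (fun x => ?_) (fun x => ?_) (a := -(R : ℝ)) (fun x hx => ?_)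
  · simp only [ProbabilityMeasure.coe_mk, Measure.map_id']
    rw [hQ φ hφ, integral_expIntensity (by positivity)]
    refine hlim.congr fun N => ?_
    rw [integral_map (hmeas N).aemeasurable (Measurable.aestronglyMeasurable (by fun_prop)), hμ N]
    simp_rw [LocFinMeasure.integral_ofPoints, Complex.ofReal_sum, Finset.sum_mul, Complex.exp_sum,
      add_sub_cancel]
    rw [integral_fintype_prod_eq_prod (fun (_ : Config N) (x : ℝ) =>
      Complex.exp (φ (x - tiltedLevel f N (b N)) * Complex.I))]
  · refine (norm_sub_le _ _).trans ?_
    rw [Complex.norm_exp_ofReal_mul_I]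
    norm_num
  · rw [add_sub_cancel, Complex.norm_exp_ofReal_mul_I]
  · rw [hR x (by rw [lt_abs]; right; linarith)]
    simp

/-- Given the field, the maximum has Gumbel fluctuations: the event that it stays below a level is
a product event, so no convergence of point processes is involved. -/
theorem tendsto_max_le {f b : ℕ → ℝ} {β v : ℝ} (hf : IsTypicalField f b β v) (z : ℝ) :
    Tendsto (fun N : ℕ =>
      (Measure.pi fun σ : Config N => gaussianReal (spinSum f N σ) N).real
        {H | (⨆ σ, H σ) - tiltedLevel f N (b N) ≤ z}) atTop
      (𝓝 (Real.exp (-(1 / √(2 * Real.pi * (1 + v)) / β * Real.exp (-β * z))))) := by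
  set C := 1 / √(2 * Real.pi * (1 + v)) with hC
  have hβ := hf.pos
  let g : ℝ → ℂ := (Set.Ioi z).indicator fun _ => -1
  have hg1 : ∀ x, 1 + g x = (Set.Iic z).indicator (fun _ => 1) x := by
    intro x
    by_cases hx : z < x
    · simp [g, Set.indicator, hx]
    · simp [g, Set.indicator, hx, not_lt.1 hx]
  have hlim := hf.tendsto_prod_integral (g := g) (measurable_const.indicator measurableSet_Ioi)
    (fun x => ?_) (fun x => ?_) (a := z) (fun x hx => ?_)
  · have e1 : ∀ N : ℕ, ∏ σ : Config N,
        ∫ x, (1 + g (x - tiltedLevel f N (b N))) ∂gaussianReal (spinSum f N σ) N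
        = (((Measure.pi fun σ : Config N => gaussianReal (spinSum f N σ) N).real
          {H | (⨆ σ, H σ) - tiltedLevel f N (b N) ≤ z} : ℝ) : ℂ) := by
      intro N
      have es : {H : Config N → ℝ | (⨆ σ, H σ) - tiltedLevel f N (b N) ≤ z}
          = Set.univ.pi fun _ => Set.Iic (z + tiltedLevel f N (b N)) := by
        ext H
        simp only [Set.mem_ofPred_eq, Set.mem_univ_pi, Set.mem_Iic, sub_le_iff_le_add]
        exact ciSup_le_iff (Set.finite_range H).bddAbove
      rw [es, measureReal_def, Measure.pi_pi, ENNReal.toReal_prod, Complex.ofReal_prod]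
      refine Finset.prod_congr rfl fun σ _ => ?_
      have e2 : ∀ x, 1 + g (x - tiltedLevel f N (b N))
          = (Set.Iic (z + tiltedLevel f N (b N))).indicator (fun _ => (1 : ℂ)) x := by
        intro x
        rw [hg1]
        simp [Set.indicator]
      simp_rw [e2]
      rw [integral_indicator_const _ measurableSet_Iic]
      simp [measureReal_def]
    have e3 : ∫ y, (C * Real.exp (-β * y)) • g y = ((-(C / β * Real.exp (-β * z)) : ℝ) : ℂ) := by
      have e4 : ∀ y, (C * Real.exp (-β * y)) • g y
          = (((Set.Ioi z).indicator (fun y => -C * Real.exp (-β * y)) y : ℝ) : ℂ) := by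
        intro y
        by_cases hy : z < y
        · simp [g, Set.indicator, hy]
        · simp [g, Set.indicator, hy]
      simp_rw [e4]
      rw [integral_complex_ofReal, integral_indicator measurableSet_Ioi, integral_const_mul,
        integral_exp_mul_Ioi (by linarith)]
      congr 1
      field_simp
    rw [e3, ← Complex.ofReal_exp] at hlim
    simp_rw [e1] at hlim
    exact (Complex.continuous_re.tendsto _).comp hlim
  · by_cases hx : z < x <;> simp [g, hx]
  · rw [hg1]
    by_cases hx : x ≤ z <;> simp [Set.indicator, hx]
  · simp [g, hx.le]

/-- The coefficient of `N` in the recentering. -/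
def linearCoeff (N : ℕ) (f : ℕ → ℝ) : ℝ :=
  empiricalBeta N f + (∑ i : Fin N, f i * Real.tanh (empiricalBeta N f * f i)) / N

/-- The coefficient of `log N` in the recentering. -/
def logCoeff (N : ℕ) (f : ℕ → ℝ) : ℝ := 1 / (2 * empiricalBeta N f)

theorem recentering_eq_tiltedLevel (N : ℕ) (f : ℕ → ℝ) :
    recentering linearCoeff logCoeff N f = tiltedLevel f N (empiricalBeta N f) := by
  rcases eq_or_ne N 0 with rfl | hN
  · simp [recentering, tiltedLevel]
  · have hN' : (N : ℝ) ≠ 0 := by exact_mod_cast hN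
    rw [recentering, tiltedLevel, linearCoeff, logCoeff, add_mul, div_mul_cancel₀ _ hN']
    ring

theorem measurable_linearCoeff (N : ℕ) : Measurable (linearCoeff N) := by
  have h1 := measurable_empiricalBeta N
  have h2 := continuous_tanh.measurable
  unfold linearCoeff
  fun_prop

theorem measurable_logCoeff (N : ℕ) : Measurable (logCoeff N) := by
  have h1 := measurable_empiricalBeta N
  unfold logCoeff
  fun_prop

end

theorem theorem2 {Ω : Type*} [MeasurableSpace Ω] (P : Measure Ω) [IsProbabilityMeasure P]
    (h : ℕ → Ω → ℝ) (X : (N : ℕ) → Config N → Ω → ℝ) (hmodel : IsREMInRandomField P h X) :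
    (∃! β : ℝ, IsCriticalBeta P h β) ∧
    ∀ βc : ℝ, IsCriticalBeta P h βc →
      ∃ c₁ c₂ : ℕ → (ℕ → ℝ) → ℝ,
        (∀ N, Measurable (c₁ N)) ∧ (∀ N, Measurable (c₂ N)) ∧
        -- quenched weak convergence of the recentered point process to a Poisson process
        (∃ Q : ProbabilityMeasure LocFinMeasure,
          IsPoissonProcess (expIntensity (extremalConst P h βc) βc) (fun ξ => ξ)
            (Q : Measure LocFinMeasure) ∧
          ∀ᵐ ω ∂P, TendstoInDistribution
            (fun (N : ℕ) (H : Config N → ℝ) => LocFinMeasure.ofPoints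
              (fun σ => H σ - recentering c₁ c₂ N (fun i => h i ω)))
            atTop (fun ξ => ξ) (fun N => quenchedLaw P h X N (fun i => h i ω))
            (Q : Measure LocFinMeasure)) ∧
        -- limits of the coefficients of the recentering
        (∀ᵐ ω ∂P, Tendsto (fun N => c₁ N (fun i => h i ω)) atTop
          (𝓝 (maxEnergyDensity P h βc))) ∧
        (∀ᵐ ω ∂P, Tendsto (fun N => c₂ N (fun i => h i ω)) atTop (𝓝 (1 / (2 * βc)))) ∧
        -- quenched Gumbel fluctuations of the maximum
        (∀ᵐ ω ∂P, ∀ z : ℝ, Tendsto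
          (fun N => (quenchedLaw P h X N (fun i => h i ω)).real
            {H | (⨆ σ, H σ) - recentering c₁ c₂ N (fun i => h i ω) ≤ z})
          atTop
          (𝓝 (Real.exp (-(extremalConst P h βc / βc * Real.exp (-βc * z)))))) := by
  refine ⟨existsUnique_isCriticalBeta hmodel, fun β hβ => ⟨linearCoeff, logCoeff,
    measurable_linearCoeff, measurable_logCoeff, ?_, ?_, ?_, ?_⟩⟩
  · have := isLocallyFiniteMeasure_expIntensity (extremalConst P h β) β
    refine ⟨⟨poissonLaw (expIntensity (extremalConst P h β) β), inferInstance⟩,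
      isPoissonProcess_poissonLaw _, ?_⟩
    filter_upwards [ae_isTypicalField hmodel hβ,
      ae_all_iff.2 fun N => ae_quenchedLaw_eq hmodel N] with ω hω hlaw
    simp_rw [recentering_eq_tiltedLevel]
    exact tendstoInDistribution_ofPoints hω.1 hlaw fun g hg => charFunctional_poissonLaw _ hg
  · filter_upwards [ae_isTypicalField hmodel hβ] with ω hω
    exact hω.1.tendsto.add hω.2
  · filter_upwards [ae_isTypicalField hmodel hβ] with ω hω
    have := hω.1.pos
    exact tendsto_const_nhds.div (hω.1.tendsto.const_mul 2) (by positivity)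
  · filter_upwards [ae_isTypicalField hmodel hβ,
      ae_all_iff.2 fun N => ae_quenchedLaw_eq hmodel N] with ω hω hlaw z
    simp_rw [recentering_eq_tiltedLevel, hlaw]
    exact tendsto_max_le hω.1 z
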